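/- Let $m\ge 1$ be an integer, let $p>1$, and suppose that \[ \max\{1,p-1\}<q\le \frac pm+p-1 . \] Let $S=\mathbb R^m\times[0,\infty)$ with Lebesgue measure $dx\,dt$, and let $u_0\in L^1_{loc}(\mathbb R^m)$ with $u_0\ge 0$ a.e. Let $u$ be a nonnegative weak solution of \[ \partial_t u-\operatorname{div}\left(|\nabla u|^{p-2}\nabla u\right)\ge u^q \ \text{ in } \mathbb R^m\times(0,\infty),\qquad u=u_0 \ \text{ on } \mathbb R^m\times\{0\}, \] that is: $u\in W^{1,p}_{loc}(S)\cap L^q_{loc}(S)$, $u\ge0$ a.e., and \[ \int_S \psi\,u^q\,dx\,dt\ \le\ \int_S |\nabla u|^{p-2}\langle\nabla u,\nabla\psi\rangle\,dx\,dt-\int_S u\,\partial_t\psi\,dx\,dt-\int_{\mathbb R^m}u_0(x)\,\psi(x,0)\,dx \] for every $\psi\in W^{1,p}(S)$ with $\psi\ge 0$ a.e. and compact support in $S$ for which $\psi u^q$ and $u\,\partial_t\psi$ are integrable on $S$ and $u_0\psi(\cdot,0)$ is integrable on $\mathbb R^m$; here $\psi(\cdot,0)$ is the trace of $\psi$ on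 $t=0$. Then $u=0$ a.e. in $S$. -/

import Mathlib

open MeasureTheory Set
open scoped ContDiff

namespace PLaplaceParabolic

/-- The flat space `ℝ^m` with its Euclidean norm and inner product. -/
abbrev Space (m : ℕ) : Type := EuclideanSpace ℝ (Fin m)

/-- The ambient space-time `ℝ^m × ℝ`. Functions on `ℝ^m × [0, ∞)` are represented by functions on
`Space m × ℝ`, of which only the values at positive times matter. -/
abbrev SpaceTime (m : ℕ) : Type := Space m × ℝ

/-- The open upper half-space `ℝ^m × (0, ∞)`. -/
def upper (m : ℕ) : Set (SpaceTime m) := {z | 0 < z.2}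

/-- Lebesgue measure `dx dt` on `ℝ^m × [0, ∞)` (the slice `t = 0` is a null set). -/
noncomputable def muS (m : ℕ) : Measure (SpaceTime m) := volume.restrict (upper m)

/-- `f ∈ L^p_loc(ℝ^m × [0, ∞))`: `L^p` on every compact set, also on those that meet `t = 0`. -/
def MemLpLoc {m : ℕ} {F : Type*} [NormedAddCommGroup F] (f : SpaceTime m → F) (p : ℝ) : Prop :=
  ∀ K : Set (SpaceTime m), IsCompact K → MemLp f (ENNReal.ofReal p) ((muS m).restrict K)

/-- `G` is the weak spatial gradient `∇f` and `w` the weak time derivative `∂_t f` of `f` in the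
open set `ℝ^m × (0, ∞)`, tested against smooth functions with compact support in that set.
(It is only used together with local integrability of `f`, `G` and `w`.) -/
structure HasWeakDerivs {m : ℕ} (f : SpaceTime m → ℝ) (G : SpaceTime m → Space m)
    (w : SpaceTime m → ℝ) : Prop where
  grad : ∀ φ : SpaceTime m → ℝ, ContDiff ℝ ∞ φ → HasCompactSupport φ → tsupport φ ⊆ upper m →
    ∀ v : Space m, ∫ z, f z * fderiv ℝ φ z (v, 0) ∂(muS m) = -∫ z, inner ℝ (G z) v * φ z ∂(muS m)
  time : ∀ φ : SpaceTime m → ℝ, ContDiff ℝ ∞ φ → HasCompactSupport φ → tsupport φ ⊆ upper m →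
    ∫ z, f z * fderiv ℝ φ z (0, 1) ∂(muS m) = -∫ z, w z * φ z ∂(muS m)

/-- `f ∈ W^{1,p}_loc(ℝ^m × [0, ∞))` with weak derivatives `∇f = G` and `∂_t f = w`. -/
structure MemW1pLoc {m : ℕ} (p : ℝ) (f : SpaceTime m → ℝ) (G : SpaceTime m → Space m)
    (w : SpaceTime m → ℝ) : Prop where
  memLp : MemLpLoc f p
  memLp_grad : MemLpLoc G p
  memLp_time : MemLpLoc w p
  derivs : HasWeakDerivs f G w

/-- `f ∈ W^{1,p}(ℝ^m × [0, ∞))` with weak derivatives `∇f = G` and `∂_t f = w`. -/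
structure MemW1p {m : ℕ} (p : ℝ) (f : SpaceTime m → ℝ) (G : SpaceTime m → Space m)
    (w : SpaceTime m → ℝ) : Prop where
  memLp : MemLp f (ENNReal.ofReal p) (muS m)
  memLp_grad : MemLp G (ENNReal.ofReal p) (muS m)
  memLp_time : MemLp w (ENNReal.ofReal p) (muS m)
  derivs : HasWeakDerivs f G w

/-- `g` is the trace `f(·, 0)` on `t = 0` of a Sobolev function `f` with weak time derivative `w`:
the locally integrable function, unique up to null sets, for which integration by parts in time
holds against smooth compactly supported functions that need not vanish at `t = 0`. -/
structure HasTrace {m : ℕ} (f w : SpaceTime m → ℝ) (g : Space m → ℝ) : Prop where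
  locallyIntegrable : LocallyIntegrable g volume
  green : ∀ φ : SpaceTime m → ℝ, ContDiff ℝ ∞ φ → HasCompactSupport φ →
    ∫ z, (f z * fderiv ℝ φ z (0, 1) + w z * φ z) ∂(muS m) = -∫ x, g x * φ (x, 0)

/-- The test functions: `ψ ∈ W^{1,p}(ℝ^m × [0, ∞))`, `ψ ≥ 0` a.e., with compact support in
`ℝ^m × [0, ∞)` (the support may meet `t = 0`). Here `∇ψ = G`, `∂_t ψ = w` and `ψ(·, 0) = g`. -/
structure IsTestFunction {m : ℕ} (p : ℝ) (ψ : SpaceTime m → ℝ) (G : SpaceTime m → Space m)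
    (w : SpaceTime m → ℝ) (g : Space m → ℝ) : Prop where
  memW1p : MemW1p p ψ G w
  trace : HasTrace ψ w g
  nonneg : ∀ᵐ z ∂(muS m), 0 ≤ ψ z
  compactSupport : ∃ K : Set (SpaceTime m), IsCompact K ∧ ∀ᵐ z ∂(muS m), z ∉ K → ψ z = 0

/-- `u` is a (nonnegative) weak solution of
`∂_t u - div(|∇u|^{p-2} ∇u) ≥ V u^q` in `ℝ^m × (0, ∞)`, `u = u₀` on `ℝ^m × {0}`.

For a general test function `ψ` in `W^{1,p}` the integrals of `ψ u^q V`, `u ∂_t ψ` and `u₀ ψ(·, 0)`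
need not converge, so the inequality is required exactly for the `ψ` for which they do. The integral
of `|∇u|^{p-2} ⟨∇u, ∇ψ⟩` always converges (the integrand is `0` where `∇u = 0`). -/
def IsWeakSolution {m : ℕ} (p q : ℝ) (V : SpaceTime m → ℝ) (u₀ : Space m → ℝ)
    (u : SpaceTime m → ℝ) : Prop :=
  ∃ (Gu : SpaceTime m → Space m) (wu : SpaceTime m → ℝ),
    MemW1pLoc p u Gu wu ∧
    (∀ K : Set (SpaceTime m), IsCompact K → IntegrableOn (fun z => |u z| ^ q * V z) K (muS m)) ∧
    (∀ᵐ z ∂(muS m), 0 ≤ u z) ∧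
    ∀ (ψ : SpaceTime m → ℝ) (G : SpaceTime m → Space m) (w : SpaceTime m → ℝ) (g : Space m → ℝ),
      IsTestFunction p ψ G w g →
      Integrable (fun z => ψ z * u z ^ q * V z) (muS m) →
      Integrable (fun z => u z * w z) (muS m) →
      Integrable (fun x => u₀ x * g x) volume →
      ∫ z, ψ z * u z ^ q * V z ∂(muS m) ≤
        ∫ z, ‖Gu z‖ ^ (p - 2) * inner ℝ (Gu z) (G z) ∂(muS m)
          - ∫ z, u z * w z ∂(muS m) - ∫ x, u₀ x * g x

end PLaplaceParabolic

/-!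
The proof is the nonlinear capacity method. The inequality is tested with `f(u) φ`, where
`φ = ξ ^ k * η` is a cutoff and `f(s) = 1 + (1 + s / T) ^ (-α)` is a bounded decreasing multiplier
with small `α > 0`. Since `f' < 0`, the diffusion term produces a negative multiple of
`|∇u| ^ p (1 + u / T) ^ (-α - 1) φ`, and by Young's inequality (`flux_le`) this absorbs the product
of `|∇u| ^ (p - 1)` with `∇φ`. What remains is a power of `1 + u / T` with exponent
`(α + 1) (p - 1) < q`, which is controlled by `1 + (u / T) ^ q` and does not involve `∇u` any more.

The factor `η` only depends on time, vanishes near `t = 0` and is nondecreasing. Its derivative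
therefore enters with a favourable sign, and neither the initial datum nor traces play a role beyond
the trivial trace of a function that vanishes near `t = 0`. The result (`integral_cutoff_le`), with
space scale `R`, time scale `Θ` and level `T = τ R ^ (-p / (q - p + 1))` balanced as in
`scales_balance`, is
`∫ u ^ q φ ≤ C (τ ^ (p - 1) + τ) + C (τ ^ (p - 1 - q) + τ ^ (1 - q)) ∫_A u ^ q φ`,
uniformly in `R ≥ 1`, where `A` is the region on which `ξ` is not constant. Boundedness of the first
term is exactly the condition `q ≤ p / m + p - 1`. For `τ` large the last term is absorbed, so
`u ^ q η` is integrable; then the integral over `A` vanishes as `R → ∞`, and `τ → 0` gives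
`∫ u ^ q η = 0`. The critical exponent needs no separate argument.

To use `f(u) φ` as a test function one needs the chain rule for weak derivatives
(`HasWeakDirDeriv.comp`), which is proved by mollification; the `L¹` convergence of the mollified
functions follows from their almost everywhere convergence by a form of Scheffé's lemma.
-/

namespace PLaplaceParabolic

open Filter
open scoped Topology Convolution

/-! ### Weak directional derivatives and the chain rule -/

/-- A form of Scheffé's lemma. The functions `|g n| + |f| - |g n - f|` are dominated by `2 |f|`. -/
theorem tendsto_integral_abs_sub_of_ae_tendsto {α : Type*} [MeasurableSpace α] {μ : Measure α}
    {g : ℕ → α → ℝ} {f : α → ℝ} (hf : Integrable f μ) (hg : ∀ n, Integrable (g n) μ)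
    (hlim : ∀ᵐ x ∂μ, Tendsto (fun n => g n x) atTop (𝓝 (f x)))
    (hnorm : ∀ n, ∫ x, |g n x| ∂μ ≤ ∫ x, |f x| ∂μ) :
    Tendsto (fun n => ∫ x, |g n x - f x| ∂μ) atTop (𝓝 0) := by
  have key : Tendsto (fun n => ∫ x, (|g n x| + |f x| - |g n x - f x|) ∂μ) atTop
      (𝓝 (∫ x, 2 * |f x| ∂μ)) := by
    refine tendsto_integral_of_dominated_convergence (fun x => 2 * |f x|) (fun n => ?_)
      (hf.abs.const_mul 2) (fun n => ?_) ?_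
    · exact (((hg n).abs.add hf.abs).sub ((hg n).sub hf).abs).aestronglyMeasurable
    · refine ae_of_all _ fun x => ?_
      rw [Real.norm_eq_abs, abs_le]
      have h1 := abs_sub_abs_le_abs_sub (g n x) (f x)
      have h2 := abs_sub (g n x) (f x)
      have h3 := abs_nonneg (f x)
      constructor <;> linarith
    · filter_upwards [hlim] with x hx
      have := (hx.abs.add_const |f x|).sub (hx.sub_const (f x)).abs
      simpa [two_mul] using this
  rw [integral_const_mul] at key
  have key2 : Tendsto (fun n => 2 * ∫ x, |f x| ∂μ
      - ∫ x, (|g n x| + |f x| - |g n x - f x|) ∂μ) atTop (𝓝 0) := by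
    simpa using key.const_sub (2 * ∫ x, |f x| ∂μ)
  refine squeeze_zero (fun n => integral_nonneg fun x => abs_nonneg _) (fun n => ?_) key2
  have h1 := integral_sub ((hg n).abs.add hf.abs) ((hg n).sub hf).abs
  have h2 := integral_add (hg n).abs hf.abs
  simp only [Pi.add_apply, Pi.sub_apply] at h1
  linarith [hnorm n]

theorem exists_abs_le_of_hasCompactSupport {E : Type*} [NormedAddCommGroup E] {φ : E → ℝ}
    (hφ : Continuous φ) (hc : HasCompactSupport φ) : ∃ M, 0 ≤ M ∧ ∀ z, |φ z| ≤ M := by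
  obtain ⟨M, hM⟩ := hc.exists_bound_of_continuous hφ
  exact ⟨M, (norm_nonneg _).trans (hM 0), hM⟩

theorem continuous_fderiv_apply {E : Type*} [NormedAddCommGroup E] [NormedSpace ℝ E]
    {φ : E → ℝ} (hφ : ContDiff ℝ ∞ φ) (e : E) :
    Continuous fun z => fderiv ℝ φ z e :=
  (hφ.continuous_fderiv (by simp)).clm_apply continuous_const

theorem hasCompactSupport_fderiv_apply {E : Type*} [NormedAddCommGroup E] [NormedSpace ℝ E]
    {φ : E → ℝ} (hφ : HasCompactSupport φ) (e : E) :
    HasCompactSupport fun z => fderiv ℝ φ z e :=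
  hφ.fderiv_apply ℝ e

theorem _root_.MeasureTheory.LocallyIntegrable.integrable_mul_of_hasCompactSupport
    {E : Type*} [NormedAddCommGroup E] [MeasurableSpace E] [BorelSpace E] {ν : Measure E}
    {u g : E → ℝ} (hu : LocallyIntegrable u ν) (hg : Continuous g) (hgc : HasCompactSupport g) :
    Integrable (fun z => u z * g z) ν := by
  simpa using hu.integrable_smul_right_of_hasCompactSupport hg hgc

section WeakDeriv

variable {E : Type*} [NormedAddCommGroup E] [NormedSpace ℝ E] [MeasurableSpace E]

/-- `w` is the weak derivative of `u` in the direction `e` on the set `U`, tested against smooth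
functions with compact support in `U`. Local integrability of `u` and `w` is not part of the
definition. -/
def HasWeakDirDeriv (μ : Measure E) (U : Set E) (e : E) (u w : E → ℝ) : Prop :=
  ∀ φ : E → ℝ, ContDiff ℝ ∞ φ → HasCompactSupport φ → tsupport φ ⊆ U →
    ∫ z, u z * fderiv ℝ φ z e ∂(μ.restrict U) = -∫ z, w z * φ z ∂(μ.restrict U)

variable [BorelSpace E]

/-- The product rule for a smooth factor `φ` with compact support in `U`. Since `φ` localises to
`U`, the test function `θ` need not have compact support in `U`. -/
theorem HasWeakDirDeriv.integral_mul_smooth {μ : Measure E} {U : Set E} {e : E} {u w : E → ℝ}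
    (h : HasWeakDirDeriv μ U e u w) (hu : LocallyIntegrable u (μ.restrict U))
    (hw : LocallyIntegrable w (μ.restrict U)) {φ : E → ℝ} (hφ : ContDiff ℝ ∞ φ)
    (hφc : HasCompactSupport φ) (hφU : tsupport φ ⊆ U) {θ : E → ℝ} (hθ : ContDiff ℝ ∞ θ) :
    ∫ z, (u z * φ z) * fderiv ℝ θ z e ∂(μ.restrict U)
      = -∫ z, (w z * φ z + u z * fderiv ℝ φ z e) * θ z ∂(μ.restrict U) := by
  have key := h (fun z => φ z * θ z) (hφ.mul hθ) hφc.mul_right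
    ((closure_mono (Function.support_mul_subset_left _ _)).trans hφU)
  have hder : ∀ z, fderiv ℝ (fun z => φ z * θ z) z e
      = φ z * fderiv ℝ θ z e + fderiv ℝ φ z e * θ z := fun z => by
    rw [fderiv_fun_mul (hφ.differentiable (by simp) z) (hθ.differentiable (by simp) z)]
    simp [mul_comm]
  simp_rw [hder, mul_add] at key
  have i1 : Integrable (fun z => u z * (φ z * fderiv ℝ θ z e)) (μ.restrict U) :=
    hu.integrable_mul_of_hasCompactSupport (hφ.continuous.mul (continuous_fderiv_apply hθ e))
      hφc.mul_right
  have i2 : Integrable (fun z => u z * (fderiv ℝ φ z e * θ z)) (μ.restrict U) :=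
    hu.integrable_mul_of_hasCompactSupport ((continuous_fderiv_apply hφ e).mul hθ.continuous)
      (hasCompactSupport_fderiv_apply hφc e).mul_right
  have i3 : Integrable (fun z => w z * (φ z * θ z)) (μ.restrict U) :=
    hw.integrable_mul_of_hasCompactSupport (hφ.continuous.mul hθ.continuous) hφc.mul_right
  rw [integral_add i1 i2] at key
  simp_rw [add_mul, mul_assoc]
  rw [integral_add i3 i2]
  linarith

variable [FiniteDimensional ℝ E] {μ : Measure E} [μ.IsAddHaarMeasure]

/-- A sequence of bump functions shrinking to the origin, used as mollifiers. -/
noncomputable def mollifier (E : Type*) [NormedAddCommGroup E] (n : ℕ) : ContDiffBump (0 : E) where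
  rIn := 1 / ((n : ℝ) + 1)
  rOut := 2 / ((n : ℝ) + 1)
  rIn_pos := by positivity
  rIn_lt_rOut := by gcongr; norm_num

/-- The mollification of `v` at scale `1 / (n + 1)`. -/
noncomputable def mollify (μ : Measure E) (n : ℕ) (v : E → ℝ) : E → ℝ :=
  (mollifier E n).normed μ ⋆[ContinuousLinearMap.lsmul ℝ ℝ, μ] v

theorem contDiff_mollify {v : E → ℝ} (hv : LocallyIntegrable v μ) (n : ℕ) :
    ContDiff ℝ ∞ (mollify μ n v) :=
  (mollifier E n).hasCompactSupport_normed.contDiff_convolution_left _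
    (mollifier E n).contDiff_normed hv

theorem integrable_mollify {v : E → ℝ} (hv : Integrable v μ) (n : ℕ) :
    Integrable (mollify μ n v) μ :=
  ((mollifier E n).integrable_normed).integrable_convolution _ hv

theorem ae_tendsto_mollify {v : E → ℝ} (hv : LocallyIntegrable v μ) :
    ∀ᵐ z ∂μ, Tendsto (fun n => mollify μ n v z) atTop (𝓝 (v z)) := by
  refine ContDiffBump.ae_convolution_tendsto_right_of_locallyIntegrable (K := 2) ?_
    (Eventually.of_forall fun n => ?_) hv
  · have := (tendsto_one_div_add_atTop_nhds_zero_nat (𝕜 := ℝ)).const_mul 2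
    simpa [mollifier, div_eq_mul_inv] using this
  · simp [mollifier, div_eq_mul_inv]

theorem tendsto_integral_abs_mollify_sub {v : E → ℝ} (hv : Integrable v μ) :
    Tendsto (fun n => ∫ z, |mollify μ n v z - v z| ∂μ) atTop (𝓝 0) := by
  refine tendsto_integral_abs_sub_of_ae_tendsto hv (integrable_mollify hv)
    (ae_tendsto_mollify hv.locallyIntegrable) fun n => ?_
  have hint := integral_convolution (μ := μ) (ν := μ) (ContinuousLinearMap.lsmul ℝ ℝ)
    ((mollifier E n).integrable_normed (μ := μ)) hv.abs
  rw [(mollifier E n).integral_normed] at hint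
  simp only [ContinuousLinearMap.lsmul_apply, one_smul] at hint
  rw [← hint]
  refine integral_mono (integrable_mollify hv n).abs (integrable_mollify hv.abs n) fun z => ?_
  simp only [mollify, convolution_def, ContinuousLinearMap.lsmul_apply, smul_eq_mul]
  refine abs_integral_le_integral_abs.trans (le_of_eq ?_)
  refine integral_congr_ae (ae_of_all _ fun t => ?_)
  simp [abs_of_nonneg ((mollifier E n).nonneg_normed t)]

theorem HasWeakDirDeriv.fderiv_mollify {e : E} {v w : E → ℝ}
    (h : HasWeakDirDeriv μ univ e v w) (hv : LocallyIntegrable v μ) (n : ℕ) (z : E) :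
    fderiv ℝ (mollify μ n v) z e = mollify μ n w z := by
  set ρ : E → ℝ := (mollifier E n).normed μ
  have hρs : ContDiff ℝ ∞ ρ := (mollifier E n).contDiff_normed
  have hρc : HasCompactSupport ρ := (mollifier E n).hasCompactSupport_normed
  have hflip : ∀ g : E → ℝ, mollify μ n g
      = g ⋆[(ContinuousLinearMap.lsmul ℝ ℝ).flip, μ] ρ := fun g => convolution_flip _ |>.symm
  have hd := hρc.hasFDerivAt_convolution_right (ContinuousLinearMap.lsmul ℝ ℝ).flip (μ := μ)
    hv (hρs.of_le (by simp)) z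
  rw [hflip, hflip, hd.fderiv, convolution_precompR_apply _ hv (hρc.fderiv ℝ)
    (hρs.continuous_fderiv (by simp)), convolution_def, convolution_def]
  have hθ : ContDiff ℝ ∞ fun t => ρ (z - t) := hρs.comp (contDiff_const.sub contDiff_id)
  have hder : ∀ t, fderiv ℝ (fun t => ρ (z - t)) t e = -fderiv ℝ ρ (z - t) e := fun t => by
    have h1 := (hρs.differentiable (by simp) (z - t)).hasFDerivAt.comp t
      ((hasFDerivAt_const z t).sub (hasFDerivAt_id t))
    have h2 : fderiv ℝ (fun t => ρ (z - t)) t = _ := h1.fderiv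
    rw [h2]; simp
  have key := h _ hθ (hρc.comp_homeomorph (Homeomorph.subLeft z)) (subset_univ _)
  simp only [Measure.restrict_univ, hder, mul_neg, integral_neg, neg_inj] at key
  simpa [mul_comm] using key

/-- The chain rule on the whole space, by mollification. The functions `f' ∘ v` only converge almost
everywhere, but are bounded, while the derivatives converge in `L¹`. -/
theorem HasWeakDirDeriv.comp_of_integrable {e : E} {v w : E → ℝ}
    (h : HasWeakDirDeriv μ univ e v w) (hv : Integrable v μ) (hw : Integrable w μ)
    {f f' : ℝ → ℝ} (hf : ∀ s, HasDerivAt f (f' s) s) (hf' : Continuous f') {C : ℝ}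
    (hC : ∀ s, |f' s| ≤ C) :
    HasWeakDirDeriv μ univ e (fun z => f (v z)) (fun z => f' (v z) * w z) := by
  intro θ hθ hθc _
  rw [Measure.restrict_univ]
  have hfc : Continuous f := continuous_iff_continuousAt.2 fun s => (hf s).continuousAt
  have hf1 : ContDiff ℝ 1 f := by
    refine contDiff_one_iff_deriv.2 ⟨fun s => (hf s).differentiableAt, ?_⟩
    rwa [show deriv f = f' from funext fun s => (hf s).deriv]
  have hC0 : 0 ≤ C := (abs_nonneg _).trans (hC 0)
  have hlip : ∀ a b, |f a - f b| ≤ C * |a - b| := fun a b =>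
    Convex.norm_image_sub_le_of_norm_hasDerivWithin_le (s := univ) (x := b) (y := a)
      (fun s _ => (hf s).hasDerivWithinAt) (fun s _ => hC s) convex_univ (mem_univ _) (mem_univ _)
  obtain ⟨M, hM0, hM⟩ := exists_abs_le_of_hasCompactSupport (continuous_fderiv_apply hθ e)
    (hasCompactSupport_fderiv_apply hθc e)
  obtain ⟨N, hN0, hN⟩ := exists_abs_le_of_hasCompactSupport hθ.continuous hθc
  have hvn : ∀ n, Continuous (mollify μ n v) := fun n =>
    (contDiff_mollify hv.locallyIntegrable n).continuous
  have hwn : ∀ n, Continuous (mollify μ n w) := fun n =>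
    (contDiff_mollify hw.locallyIntegrable n).continuous
  have hparts : ∀ n, ∫ z, f (mollify μ n v z) * fderiv ℝ θ z e ∂μ
      = -∫ z, (f' (mollify μ n v z) * mollify μ n w z) * θ z ∂μ := fun n => by
    have hvs := contDiff_mollify (μ := μ) hv.locallyIntegrable n
    have hder : ∀ z, fderiv ℝ (fun z => f (mollify μ n v z)) z e
        = f' (mollify μ n v z) * mollify μ n w z := fun z => by
      have h1 : HasFDerivAt (fun z => f (mollify μ n v z)) _ z := (hf _).comp_hasFDerivAt z
        (hvs.differentiable (by simp) z).hasFDerivAt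
      rw [h1.fderiv]
      simp [h.fderiv_mollify hv.locallyIntegrable n z]
    have hcs := hasCompactSupport_fderiv_apply hθc e
    have := integral_mul_fderiv_eq_neg_fderiv_mul_of_integrable (μ := μ)
      (f := fun z => f (mollify μ n v z)) (g := θ) (v := e) ?_ ?_ ?_
      (fun z _ => (hf _).differentiableAt.comp z (hvs.differentiable (by simp) z))
      (fun z _ => hθ.differentiable (by simp) z)
    · simpa only [hder] using this
    · simp only [hder]
      exact (((hf'.comp (hvn n)).mul (hwn n)).mul hθ.continuous).integrable_of_hasCompactSupport
        hθc.mul_left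
    · exact ((hfc.comp (hvn n)).mul (continuous_fderiv_apply hθ e)).integrable_of_hasCompactSupport
        hcs.mul_left
    · exact ((hfc.comp (hvn n)).mul hθ.continuous).integrable_of_hasCompactSupport hθc.mul_left
  have hfv : LocallyIntegrable (fun z => f (v z)) μ := by
    refine ((locallyIntegrable_const |f 0|).add
      (hv.abs.const_mul C).locallyIntegrable).mono
      (hfc.comp_aestronglyMeasurable hv.aestronglyMeasurable) (ae_of_all _ fun z => ?_)
    have h1 := hlip (v z) 0
    have h2 := abs_sub_abs_le_abs_sub (f (v z)) (f 0)
    rw [sub_zero] at h1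
    have h3 : |f (v z)| ≤ |f 0| + C * |v z| := by linarith
    exact h3.trans (le_abs_self _)
  have lim1 : Tendsto (fun n => ∫ z, f (mollify μ n v z) * fderiv ℝ θ z e ∂μ) atTop
      (𝓝 (∫ z, f (v z) * fderiv ℝ θ z e ∂μ)) := by
    rw [tendsto_iff_norm_sub_tendsto_zero]
    have hz := (tendsto_integral_abs_mollify_sub hv).const_mul (C * M)
    rw [mul_zero] at hz
    refine squeeze_zero (fun n => norm_nonneg _) (fun n => ?_) hz
    rw [← integral_sub, ← integral_const_mul]
    · refine (norm_integral_le_integral_norm _).trans (integral_mono_of_nonneg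
        (ae_of_all _ fun z => norm_nonneg _) ?_ (ae_of_all _ fun z => ?_))
      · exact ((integrable_mollify hv n).sub hv).abs.const_mul _
      · simp only [← sub_mul, Real.norm_eq_abs, abs_mul]
        calc _ ≤ (C * |mollify μ n v z - v z|) * M := by gcongr; exacts [hlip _ _, hM z]
          _ = _ := by ring
    · exact ((hfc.comp (hvn n)).mul (continuous_fderiv_apply hθ e)).integrable_of_hasCompactSupport
        (hasCompactSupport_fderiv_apply hθc e).mul_left
    · exact hfv.integrable_mul_of_hasCompactSupport (continuous_fderiv_apply hθ e)
        (hasCompactSupport_fderiv_apply hθc e)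
  have bdd : ∀ {x : E → ℝ} {a : E → ℝ}, Integrable a μ → AEStronglyMeasurable x μ →
      Integrable (fun z => f' (x z) * a z * θ z) μ := fun ha hx =>
    ((ha.bdd_mul (c := C) (hf'.comp_aestronglyMeasurable hx) (ae_of_all _ fun z => hC _)).mul_bdd
      (c := N) hθ.continuous.aestronglyMeasurable (ae_of_all _ hN))
  have lim2 : Tendsto (fun n => ∫ z, (f' (mollify μ n v z) * w z) * θ z ∂μ) atTop
      (𝓝 (∫ z, (f' (v z) * w z) * θ z ∂μ)) := by
    refine tendsto_integral_of_dominated_convergence (fun z => C * |w z| * N)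
      (fun n => (bdd hw (hvn n).aestronglyMeasurable).aestronglyMeasurable)
      ((hw.abs.const_mul C).mul_const N) (fun n => ae_of_all _ fun z => ?_) ?_
    · rw [Real.norm_eq_abs, abs_mul, abs_mul]
      gcongr
      exacts [hC _, hN z]
    · filter_upwards [ae_tendsto_mollify hv.locallyIntegrable] with z hz
      exact (((hf'.tendsto _).comp hz).mul_const _).mul_const _
  have lim3 : Tendsto (fun n => ∫ z, (f' (mollify μ n v z) * mollify μ n w z) * θ z ∂μ
      - ∫ z, (f' (mollify μ n v z) * w z) * θ z ∂μ) atTop (𝓝 0) := by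
    rw [tendsto_zero_iff_norm_tendsto_zero]
    have hz := (tendsto_integral_abs_mollify_sub hw).const_mul (C * N)
    rw [mul_zero] at hz
    refine squeeze_zero (fun n => norm_nonneg _) (fun n => ?_) hz
    rw [← integral_sub (bdd (integrable_mollify hw n) (hvn n).aestronglyMeasurable)
      (bdd hw (hvn n).aestronglyMeasurable), ← integral_const_mul]
    refine (norm_integral_le_integral_norm _).trans (integral_mono_of_nonneg
        (ae_of_all _ fun z => norm_nonneg _) ?_ (ae_of_all _ fun z => ?_))
    · exact ((integrable_mollify hw n).sub hw).abs.const_mul _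
    · simp only [← sub_mul, ← mul_sub, Real.norm_eq_abs, abs_mul]
      calc _ ≤ C * |mollify μ n w z - w z| * N := by gcongr; exacts [hC _, hN z]
        _ = _ := by ring
  have lim4 := (lim3.add lim2).neg
  simp only [sub_add_cancel, zero_add, ← hparts] at lim4
  exact tendsto_nhds_unique lim1 lim4

/-- The chain rule for weak derivatives on an open set. -/
theorem HasWeakDirDeriv.comp {U : Set E} (hU : IsOpen U) {e : E} {u w : E → ℝ}
    (h : HasWeakDirDeriv μ U e u w) (hu : LocallyIntegrable u (μ.restrict U))
    (hw : LocallyIntegrable w (μ.restrict U))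
    {f f' : ℝ → ℝ} (hf : ∀ s, HasDerivAt f (f' s) s) (hf' : Continuous f') {C : ℝ}
    (hC : ∀ s, |f' s| ≤ C) :
    HasWeakDirDeriv μ U e (fun z => f (u z)) (fun z => f' (u z) * w z) := by
  intro θ hθ hθc hθU
  -- a smooth cutoff which is `1` near the support of `θ`
  obtain ⟨t, ht, hθt, htU⟩ := exists_compact_between hθc hU hθU
  obtain ⟨⟨χ, hχ⟩, hχ1, hχt, -⟩ := exists_contMDiffMap_one_nhds_of_subset_interior (n := ⊤)
    (modelWithCornersSelf ℝ E) (isClosed_tsupport θ) hθt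
  have hχs : ContDiff ℝ ∞ χ := contMDiff_iff_contDiff.1 hχ
  change ∀ᶠ z in 𝓝ˢ (tsupport θ), χ z = 1 at hχ1
  change ∀ z ∉ t, χ z = 0 at hχt
  have hχsub : tsupport χ ⊆ t := closure_minimal
    (fun z hz => by_contra fun hzt => hz (hχt z hzt)) ht.isClosed
  have hχc : HasCompactSupport χ := ht.of_isClosed_subset (isClosed_tsupport χ) hχsub
  have hχU : ∀ z ∉ U, χ z = 0 := fun z hz => hχt z fun h => hz (htU h)
  have hdU : ∀ z ∉ U, fderiv ℝ χ z e = 0 := fun z hz => by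
    have : z ∉ tsupport χ := fun h => hz (htU (hχsub h))
    rw [image_eq_zero_of_notMem_tsupport (fun h => this (tsupport_fderiv_subset ℝ h))]
    rfl
  have hθU0 : ∀ z ∉ U, θ z = 0 := fun z hz =>
    image_eq_zero_of_notMem_tsupport fun h => hz (hθU h)
  have hdθU0 : ∀ z ∉ U, fderiv ℝ θ z e = 0 := fun z hz => by
    rw [image_eq_zero_of_notMem_tsupport (fun h => hz (hθU (tsupport_fderiv_subset ℝ h)))]
    rfl
  have hdχ := hasCompactSupport_fderiv_apply hχc e
  have hdχc := continuous_fderiv_apply hχs e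
  have full : ∀ {g : E → ℝ}, (∀ z ∉ U, g z = 0) → ∫ z in U, g z ∂μ = ∫ z, g z ∂μ := fun hg =>
    setIntegral_eq_integral_of_forall_compl_eq_zero hg
  have fullI : ∀ {g : E → ℝ}, (∀ z ∉ U, g z = 0) → IntegrableOn g U μ → Integrable g μ :=
    fun hg hi => (integrableOn_iff_integrable_of_support_subset
      fun z hz => by_contra fun hzU => hz (hg z hzU)).1 hi
  have iv : Integrable (fun z => u z * χ z) μ :=
    fullI (fun z hz => by simp [hχU z hz])
      (hu.integrable_mul_of_hasCompactSupport hχs.continuous hχc)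
  have iw : Integrable (fun z => w z * χ z + u z * fderiv ℝ χ z e) μ :=
    fullI (fun z hz => by simp [hχU z hz, hdU z hz])
      ((hw.integrable_mul_of_hasCompactSupport hχs.continuous hχc).add
        (hu.integrable_mul_of_hasCompactSupport hdχc hdχ))
  have hglob : HasWeakDirDeriv μ univ e (fun z => u z * χ z)
      (fun z => w z * χ z + u z * fderiv ℝ χ z e) := by
    intro φ hφ _ _
    have := h.integral_mul_smooth hu hw hχs hχc (hχsub.trans htU) hφ
    rw [full fun z hz => by simp [hχU z hz], full fun z hz => by simp [hχU z hz, hdU z hz]] at this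
    simpa using this
  have key := hglob.comp_of_integrable iv iw hf hf' hC θ hθ hθc (subset_univ _)
  rw [Measure.restrict_univ] at key
  rw [full fun z hz => by simp [hdθU0 z hz], full fun z hz => by simp [hθU0 z hz]]
  have hnear : ∀ z ∈ tsupport θ, χ =ᶠ[𝓝 z] fun _ => 1 := fun z hz =>
    (eventually_nhdsSet_iff_forall.1 hχ1) z hz
  convert key using 2
  · refine funext fun z => ?_
    by_cases hz : z ∈ tsupport θ
    · simp [(hnear z hz).self_of_nhds]
    · rw [image_eq_zero_of_notMem_tsupport (fun h => hz (tsupport_fderiv_subset ℝ h))]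
      simp
  · refine congrArg _ (funext fun z => ?_)
    by_cases hz : z ∈ tsupport θ
    · simp [(hnear z hz).self_of_nhds, (hnear z hz).fderiv_eq]
    · simp [image_eq_zero_of_notMem_tsupport hz]

end WeakDeriv

/-! ### The nonlinear multiplier and pointwise estimates -/

/-- The multiplier `f(s) = 1 + (1 + s / T) ^ (-α)`, `s ≥ 0`, extended to a `C¹` function on the
line, with its derivative `f'` and its primitive `F`. -/
theorem exists_multiplier {α T : ℝ} (hα : 0 < α) (hT : 0 < T) :
    ∃ f f' F : ℝ → ℝ, (∀ s, HasDerivAt f (f' s) s) ∧ Continuous f' ∧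
      (∀ s, |f' s| ≤ α / T) ∧ (∀ s, |s * f' s| ≤ α) ∧ (∀ s, HasDerivAt F (f s) s) ∧
      (∀ s, 0 ≤ s → 1 ≤ f s ∧ f s ≤ 2) ∧ (∀ s, 0 ≤ s → 0 ≤ F s ∧ F s ≤ 2 * s) ∧
      ∀ s, 0 ≤ s → f' s = -(α / T * (1 + s / T) ^ (-α - 1)) := by
  set b : ℝ → ℝ := fun r => α / T * (1 + |r| / T) ^ (-α - 1) with hb
  have hpos : ∀ r : ℝ, 0 < 1 + |r| / T := fun r => by positivity
  have hge : ∀ r : ℝ, 1 ≤ 1 + |r| / T := fun r => by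
    have : 0 ≤ |r| / T := by positivity
    linarith
  have hbc : Continuous b := continuous_const.mul
    ((continuous_const.add (continuous_abs.div_const T)).rpow_const fun r => Or.inl (hpos r).ne')
  have hb0 : ∀ r, 0 ≤ b r := fun r => by have := hpos r; positivity
  have hble : ∀ r, b r ≤ α / T := fun r =>
    mul_le_of_le_one_right (by positivity)
      (Real.rpow_le_one_of_one_le_of_nonpos (hge r) (by linarith))
  set f : ℝ → ℝ := fun s => 2 - ∫ r in (0 : ℝ)..s, b r with hf
  have hfd : ∀ s, HasDerivAt f (-b s) s := fun s => by
    have := (hbc.integral_hasStrictDerivAt 0 s).hasDerivAt.const_sub 2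
    simpa using this
  have hfc : Continuous f := continuous_iff_continuousAt.2 fun s => (hfd s).continuousAt
  have hfs : ∀ s, 0 ≤ s → f s = 1 + (1 + s / T) ^ (-α) := fun s hs => by
    have : ∫ r in (0 : ℝ)..s, b r = -(1 + s / T) ^ (-α) - -(1 + 0 / T) ^ (-α) := by
      refine intervalIntegral.integral_eq_sub_of_hasDerivAt
        (f := fun r => -(1 + r / T) ^ (-α)) (fun r hr => ?_) (hbc.intervalIntegrable _ _)
      rw [uIcc_of_le hs] at hr
      have hr0 : 0 < 1 + r / T := by have := hr.1; positivity
      have h1 : HasDerivAt (fun r : ℝ => 1 + r / T) (1 / T) r :=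
        ((hasDerivAt_id r).div_const T).const_add 1
      have h2 := (h1.rpow_const (p := -α) (Or.inl hr0.ne')).neg
      refine h2.congr_deriv ?_
      change _ = α / T * (1 + |r| / T) ^ (-α - 1)
      rw [abs_of_nonneg hr.1]
      ring
    change 2 - ∫ r in (0 : ℝ)..s, b r = _
    rw [this, zero_div, add_zero, Real.one_rpow]
    ring
  have hf12 : ∀ s, 0 ≤ s → 1 ≤ f s ∧ f s ≤ 2 := fun s hs => by
    rw [hfs s hs]
    have h1 : 1 ≤ 1 + s / T := by have : 0 ≤ s / T := by positivity
                                  linarith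
    have h2 := Real.rpow_le_one_of_one_le_of_nonpos h1 (z := -α) (by linarith)
    have h3 : 0 ≤ (1 + s / T) ^ (-α) := by positivity
    constructor <;> linarith
  refine ⟨f, fun s => -b s, fun s => ∫ r in (0 : ℝ)..s, f r, hfd, hbc.neg, fun s => ?_, fun s => ?_,
    fun s => (hfc.integral_hasStrictDerivAt 0 s).hasDerivAt, hf12, fun s hs => ⟨?_, ?_⟩,
    fun s hs => ?_⟩
  · rw [abs_neg, abs_of_nonneg (hb0 s)]
    exact hble s
  · rw [abs_mul, abs_neg, abs_of_nonneg (hb0 s)]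
    have h1 : (1 + |s| / T) ^ (-α - 1) * (1 + |s| / T) ≤ 1 := by
      rw [← Real.rpow_add_one (hpos s).ne']
      exact Real.rpow_le_one_of_one_le_of_nonpos (hge s) (by linarith)
    have h2 : 0 ≤ (1 + |s| / T) ^ (-α - 1) := by have := hpos s; positivity
    calc |s| * b s = α * ((1 + |s| / T) ^ (-α - 1) * (|s| / T)) := by simp only [hb]; ring
      _ ≤ α * 1 := by
        gcongr
        refine le_trans ?_ h1
        gcongr
        linarith
      _ = α := mul_one α
  · exact intervalIntegral.integral_nonneg hs fun r hr => by linarith [(hf12 r hr.1).1]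
  · calc ∫ r in (0 : ℝ)..s, f r ≤ ∫ r in (0 : ℝ)..s, (2 : ℝ) :=
        intervalIntegral.integral_mono_on hs (hfc.intervalIntegrable _ _) (by simp)
          fun r hr => (hf12 r hr.1).2
      _ = 2 * s := by simp [mul_comm]
  · simp only [hb, abs_of_nonneg hs]

/-- Young's inequality, with a constant that is easy to compute: either `2 * y ≤ c * x`, or `x` is
controlled by `y`. -/
theorem two_mul_rpow_mul_le {p x y c : ℝ} (hp : 1 < p) (hx : 0 ≤ x) (hy : 0 ≤ y) (hc : 0 < c) :
    2 * (x ^ (p - 1) * y) ≤ c * x ^ p + 2 ^ p * c ^ (1 - p) * y ^ p := by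
  have hxp : x ^ (p - 1) * x = x ^ p := by
    rw [← Real.rpow_add_one' hx (by linarith)]; ring_nf
  rcases le_total (2 * y) (c * x) with h | h
  · calc 2 * (x ^ (p - 1) * y) = x ^ (p - 1) * (2 * y) := by ring
      _ ≤ x ^ (p - 1) * (c * x) := by gcongr
      _ = c * x ^ p := by rw [← hxp]; ring
      _ ≤ _ := by
        have : 0 ≤ 2 ^ p * c ^ (1 - p) * y ^ p := by positivity
        linarith
  · have hx2 : x ≤ 2 * y / c := by rw [le_div_iff₀ hc]; linarith
    calc 2 * (x ^ (p - 1) * y) = x ^ (p - 1) * (2 * y) := by ring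
      _ ≤ (2 * y / c) ^ (p - 1) * (2 * y) := by gcongr
      _ = 2 ^ p * c ^ (1 - p) * y ^ p := by
        have h2y : (2 * y) ^ (p - 1) * (2 * y) = 2 ^ p * y ^ p := by
          rw [← Real.rpow_add_one' (by positivity) (by linarith), sub_add_cancel,
            Real.mul_rpow (by norm_num) hy]
        rw [Real.div_rpow (by positivity) hc.le, div_eq_mul_inv, ← Real.rpow_neg hc.le, neg_sub,
          mul_right_comm, h2y]
        ring
      _ ≤ _ := by
        have : 0 ≤ c * x ^ p := by positivity
        linarith

/-- If `a < q` and the exponent `r` leaves enough room, the weight `ξ ^ r` can be traded for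
`ξ ^ k` at the expense of a constant. -/
theorem rpow_mul_rpow_le {a q r y ξ : ℝ} {k : ℕ} (ha : 0 ≤ a) (haq : a ≤ q) (hq : 0 < q)
    (hr : k * (a / q) ≤ r) (hy : 0 ≤ y) (hξ0 : 0 ≤ ξ) (hξ1 : ξ ≤ 1) :
    y ^ a * ξ ^ r ≤ 1 + y ^ q * ξ ^ k := by
  set Y : ℝ := y * ξ ^ ((k : ℝ) / q) with hY
  have hY0 : 0 ≤ Y := by positivity
  have h1 : y ^ a * ξ ^ r ≤ Y ^ a := by
    rw [hY, Real.mul_rpow hy (by positivity), ← Real.rpow_mul hξ0]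
    refine mul_le_mul_of_nonneg_left ?_ (by positivity)
    refine Real.rpow_le_rpow_of_exponent_ge' hξ0 hξ1 (by positivity) ?_
    rwa [div_mul_eq_mul_div, mul_div_assoc]
  have h2 : Y ^ q = y ^ q * ξ ^ k := by
    rw [hY, Real.mul_rpow hy (by positivity), ← Real.rpow_mul hξ0, div_mul_cancel₀ _ hq.ne',
      Real.rpow_natCast]
  rw [← h2]
  refine h1.trans ?_
  have hYq : 0 ≤ Y ^ q := by positivity
  rcases le_total Y 1 with h | h
  · linarith [Real.rpow_le_one hY0 h ha]
  · linarith [Real.rpow_le_rpow_of_exponent_le h haq]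

/-- The terms with the gradient of `u`: the part of the flux that meets the derivative of the
multiplier absorbs the part that meets the gradient `D` of the cutoff `ξ ^ k * η`. -/
theorem flux_le {V : Type*} [NormedAddCommGroup V] [InnerProductSpace ℝ V] {p β f ξ η N : ℝ} {k : ℕ}
    (hp : 1 < p) (hkp : p ≤ k) (hβ : 0 < β) (hf1 : 1 ≤ f) (hf2 : f ≤ 2) (hξ0 : 0 ≤ ξ)
    (hη0 : 0 ≤ η) (hN : 0 ≤ N) {g D : V} (hD : ‖D‖ ≤ N * ξ ^ (k - 1) * η) :
    ‖g‖ ^ (p - 2) * inner ℝ g ((-β * (ξ ^ k * η)) • g + f • D)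
      ≤ 2 ^ p * N ^ p * β ^ (1 - p) * ξ ^ ((k : ℝ) - p) * η := by
  have hg1 : ‖g‖ ^ (p - 2) * ‖g‖ = ‖g‖ ^ (p - 1) := by
    rw [← Real.rpow_add_one' (norm_nonneg g) (by linarith)]; ring_nf
  have hg2 : ‖g‖ ^ (p - 2) * ‖g‖ ^ 2 = ‖g‖ ^ p := by
    rw [← Real.rpow_natCast, ← Real.rpow_add' (norm_nonneg g) (by push_cast; linarith)]
    congr 1; push_cast; ring
  have hf0 : 0 ≤ f := by linarith
  have hk1 : 1 < k := by exact_mod_cast hp.trans_le hkp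
  have hup : ‖g‖ ^ (p - 2) * inner ℝ g ((-β * (ξ ^ k * η)) • g + f • D)
      ≤ -(β * ‖g‖ ^ p * (ξ ^ k * η)) + 2 * (‖g‖ ^ (p - 1) * ‖D‖) := by
    rw [inner_add_right, inner_smul_right, inner_smul_right, real_inner_self_eq_norm_sq, mul_add]
    have h1 : f * inner ℝ g D ≤ 2 * (‖g‖ * ‖D‖) :=
      (mul_le_mul_of_nonneg_left (real_inner_le_norm g D) hf0).trans
        (mul_le_mul_of_nonneg_right hf2 (by positivity))
    have h2 : ‖g‖ ^ (p - 2) * (f * inner ℝ g D) ≤ ‖g‖ ^ (p - 2) * (2 * (‖g‖ * ‖D‖)) := by gcongr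
    rw [← hg1, ← hg2]
    nlinarith [h2]
  refine hup.trans ?_
  have hD2 : 2 * (‖g‖ ^ (p - 1) * ‖D‖) ≤ 2 * (‖g‖ ^ (p - 1) * N) * (ξ ^ (k - 1) * η) := by
    calc 2 * (‖g‖ ^ (p - 1) * ‖D‖) ≤ 2 * (‖g‖ ^ (p - 1) * (N * ξ ^ (k - 1) * η)) := by gcongr
      _ = _ := by ring
  rcases hξ0.eq_or_lt with h | hξ
  · rw [← h, zero_pow (by omega : k - 1 ≠ 0)] at hD2
    rw [← h, zero_pow (by omega : k ≠ 0)]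
    have : 0 ≤ 2 ^ p * N ^ p * β ^ (1 - p) * (0 : ℝ) ^ ((k : ℝ) - p) * η := by positivity
    linarith
  · have hY := two_mul_rpow_mul_le hp (norm_nonneg g) hN (mul_pos hβ hξ)
    have hw : 0 ≤ ξ ^ (k - 1) * η := by positivity
    have hξk : ξ ^ k = ξ ^ (k - 1) * ξ := by rw [← pow_succ]; congr 1; omega
    have hξp : ξ ^ ((k : ℝ) - p) = ξ ^ (1 - p) * ξ ^ (k - 1) := by
      rw [← Real.rpow_natCast, ← Real.rpow_add hξ]
      congr 1
      push_cast [Nat.cast_sub hk1.le]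
      ring
    have hmul := mul_le_mul_of_nonneg_right hY hw
    rw [Real.mul_rpow hβ.le hξ.le] at hmul
    rw [hξp, hξk]
    nlinarith [hmul]

/-! ### The energy inequality -/

/-- The spatial gradient of a differentiable function on space-time. -/
noncomputable def spatialGradient {m : ℕ} (φ : SpaceTime m → ℝ) (z : SpaceTime m) : Space m :=
  (InnerProductSpace.toDual ℝ (Space m)).symm
    ((fderiv ℝ φ z).comp (ContinuousLinearMap.inl ℝ (Space m) ℝ))

theorem inner_spatialGradient {m : ℕ} (φ : SpaceTime m → ℝ) (z : SpaceTime m) (v : Space m) :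
    inner ℝ (spatialGradient φ z) v = fderiv ℝ φ z (v, 0) := by
  simp [spatialGradient, InnerProductSpace.toDual_symm_apply]

theorem continuous_spatialGradient {m : ℕ} {φ : SpaceTime m → ℝ} (hφ : ContDiff ℝ ∞ φ) :
    Continuous (spatialGradient φ) :=
  (InnerProductSpace.toDual ℝ (Space m)).symm.continuous.comp
    ((hφ.continuous_fderiv (by simp)).clm_comp continuous_const)

theorem spatialGradient_of_notMem_tsupport {m : ℕ} {φ : SpaceTime m → ℝ} {z : SpaceTime m}
    (hz : z ∉ tsupport φ) : spatialGradient φ z = 0 := by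
  rw [spatialGradient,
    image_eq_zero_of_notMem_tsupport (fun h => hz (tsupport_fderiv_subset ℝ h))]
  simp

theorem norm_spatialGradient_le {m : ℕ} {φ : SpaceTime m → ℝ} {z : SpaceTime m} {B : ℝ}
    (hB : 0 ≤ B) (h : ∀ v : Space m, |fderiv ℝ φ z (v, 0)| ≤ B * ‖v‖) :
    ‖spatialGradient φ z‖ ≤ B := by
  rw [spatialGradient, LinearIsometryEquiv.norm_map]
  exact ContinuousLinearMap.opNorm_le_bound _ hB fun v => by simpa using h v

theorem isOpen_upper (m : ℕ) : IsOpen (upper m) := isOpen_lt continuous_const continuous_snd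

instance (m : ℕ) : IsLocallyFiniteMeasure (muS m) :=
  inferInstanceAs (IsLocallyFiniteMeasure (volume.restrict _))

instance (m : ℕ) : (volume : Measure (SpaceTime m)).IsAddHaarMeasure :=
  inferInstanceAs ((volume : Measure (Space m)).prod (volume : Measure ℝ)).IsAddHaarMeasure

theorem isFiniteMeasure_restrict_muS {m : ℕ} {K : Set (SpaceTime m)} (hK : IsCompact K) :
    IsFiniteMeasure ((muS m).restrict K) :=
  isFiniteMeasure_restrict.2 hK.measure_lt_top.ne

theorem MemLpLoc.locallyIntegrable {m : ℕ} {F : Type*} [NormedAddCommGroup F]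
    {f : SpaceTime m → F} {p : ℝ} (hp : 1 ≤ p) (h : MemLpLoc f p) :
    LocallyIntegrable f (muS m) := by
  refine locallyIntegrable_iff.2 fun K hK => ?_
  have := isFiniteMeasure_restrict_muS hK
  exact (h K hK).integrable (by simpa using hp)

/-- Multiplication by a bounded function that vanishes off a compact set turns local into global
`L^p` functions. -/
theorem MemLpLoc.memLp_smul {m : ℕ} {F : Type*} [NormedAddCommGroup F] [NormedSpace ℝ F]
    {f : SpaceTime m → F} {p : ℝ} (h : MemLpLoc f p) {K : Set (SpaceTime m)} (hK : IsCompact K)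
    {a : SpaceTime m → ℝ} (ha : AEStronglyMeasurable a (muS m)) {C : ℝ}
    (hC : ∀ᵐ z ∂(muS m), |a z| ≤ C) (hz : ∀ z ∉ K, a z = 0) :
    MemLp (fun z => a z • f z) (ENNReal.ofReal p) (muS m) := by
  have h1 : MemLp (fun z => a z • f z) (ENNReal.ofReal p) ((muS m).restrict K) :=
    (h K hK).smul (p := ⊤) (memLp_top_of_bound ha.restrict C (ae_restrict_of_ae hC))
  have h2 := (memLp_indicator_iff_restrict hK.measurableSet).2 h1
  refine h2.ae_eq (ae_of_all _ fun z => ?_)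
  by_cases hzK : z ∈ K
  · simp [hzK]
  · simp [hzK, hz z hzK]

theorem memLp_muS_of_bound {m : ℕ} {F : Type*} [NormedAddCommGroup F]
    {g : SpaceTime m → F} {K : Set (SpaceTime m)} (hK : IsCompact K)
    (hg : AEStronglyMeasurable g (muS m)) {C : ℝ} (hC : ∀ᵐ z ∂(muS m), ‖g z‖ ≤ C)
    (hz : ∀ z ∉ K, g z = 0) (p : ENNReal) : MemLp g p (muS m) := by
  have := isFiniteMeasure_restrict_muS hK
  have h1 : MemLp g p ((muS m).restrict K) := .of_bound hg.restrict C (ae_restrict_of_ae hC)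
  have h2 : K.indicator g = g :=
    indicator_eq_self.2 fun z h => by_contra fun hzK => h (hz z hzK)
  rw [← h2]
  exact (memLp_indicator_iff_restrict hK.measurableSet).2 h1

theorem HasWeakDerivs.hasWeakDirDeriv_space {m : ℕ} {f : SpaceTime m → ℝ}
    {G : SpaceTime m → Space m} {w : SpaceTime m → ℝ} (h : HasWeakDerivs f G w) (v : Space m) :
    HasWeakDirDeriv volume (upper m) (v, (0 : ℝ)) f (fun z => inner ℝ (G z) v) :=
  fun φ h1 h2 h3 => h.grad φ h1 h2 h3 v

theorem HasWeakDerivs.hasWeakDirDeriv_time {m : ℕ} {f : SpaceTime m → ℝ}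
    {G : SpaceTime m → Space m} {w : SpaceTime m → ℝ} (h : HasWeakDerivs f G w) :
    HasWeakDirDeriv volume (upper m) ((0 : Space m), (1 : ℝ)) f w :=
  fun φ h1 h2 h3 => h.time φ h1 h2 h3

/-- Testing the differential inequality with `f(u) φ`, where `φ` is supported away from `t = 0`.
The time derivative of `u` only enters through the primitive `F` of `f`. -/
theorem energy_inequality {m : ℕ} {p q : ℝ} (hp : 1 < p) {u₀ : Space m → ℝ} {u : SpaceTime m → ℝ}
    {Gu : SpaceTime m → Space m} {wu : SpaceTime m → ℝ} (hu : MemW1pLoc p u Gu wu)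
    (huq : ∀ K : Set (SpaceTime m), IsCompact K → IntegrableOn (fun z => |u z| ^ q) K (muS m))
    (hu0 : ∀ᵐ z ∂(muS m), 0 ≤ u z)
    (hweak : ∀ (ψ : SpaceTime m → ℝ) (G : SpaceTime m → Space m) (w : SpaceTime m → ℝ)
      (g : Space m → ℝ), IsTestFunction p ψ G w g →
      Integrable (fun z => ψ z * u z ^ q * 1) (muS m) →
      Integrable (fun z => u z * w z) (muS m) →
      Integrable (fun x => u₀ x * g x) volume →
      ∫ z, ψ z * u z ^ q * 1 ∂(muS m) ≤
        ∫ z, ‖Gu z‖ ^ (p - 2) * inner ℝ (Gu z) (G z) ∂(muS m)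
          - ∫ z, u z * w z ∂(muS m) - ∫ x, u₀ x * g x)
    {f f' F : ℝ → ℝ} {A A' : ℝ} (hf : ∀ s, HasDerivAt f (f' s) s) (hf'c : Continuous f')
    (hf' : ∀ s, |f' s| ≤ A) (hsf' : ∀ s, |s * f' s| ≤ A') (hF : ∀ s, HasDerivAt F (f s) s)
    (hfb : ∀ s, 0 ≤ s → 1 ≤ f s ∧ f s ≤ 2) (hFb : ∀ s, 0 ≤ s → 0 ≤ F s ∧ F s ≤ 2 * s)
    {φ : SpaceTime m → ℝ} (hφ : ContDiff ℝ ∞ φ) (hφc : HasCompactSupport φ)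
    (hφU : tsupport φ ⊆ upper m) (hφ0 : ∀ z, 0 ≤ φ z) :
    ∫ z, u z ^ q * φ z ∂(muS m) ≤
      ∫ z, ‖Gu z‖ ^ (p - 2) * inner ℝ (Gu z)
          ((f' (u z) * φ z) • Gu z + f (u z) • spatialGradient φ z) ∂(muS m)
        - ∫ z, F (u z) * fderiv ℝ φ z (0, 1) ∂(muS m) := by
  have hfc : Continuous f := continuous_iff_continuousAt.2 fun s => (hf s).continuousAt
  have hFc : Continuous F := continuous_iff_continuousAt.2 fun s => (hF s).continuousAt
  have hum : AEStronglyMeasurable u (muS m) :=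
    (hu.memLp.locallyIntegrable hp.le).aestronglyMeasurable
  have huL := hu.memLp.locallyIntegrable hp.le
  have hwL := hu.memLp_time.locallyIntegrable hp.le
  have hGL := hu.memLp_grad.locallyIntegrable hp.le
  have hfum : AEStronglyMeasurable (fun z => f (u z)) (muS m) :=
    hfc.comp_aestronglyMeasurable hum
  have hf'um : AEStronglyMeasurable (fun z => f' (u z)) (muS m) :=
    hf'c.comp_aestronglyMeasurable hum
  have hfub : ∀ᵐ z ∂(muS m), |f (u z)| ≤ 2 := by
    filter_upwards [hu0] with z hz
    rw [abs_of_nonneg (by linarith [(hfb _ hz).1])]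
    exact (hfb _ hz).2
  have hfuL : LocallyIntegrable (fun z => f (u z)) (muS m) :=
    (locallyIntegrable_const (2 : ℝ)).mono hfum
      (hfub.mono fun z hz => by simpa using hz)
  have hFuL : LocallyIntegrable (fun z => F (u z)) (muS m) := by
    refine (huL.smul (2 : ℝ)).mono (hFc.comp_aestronglyMeasurable hum) ?_
    filter_upwards [hu0] with z hz
    rw [Real.norm_eq_abs, abs_of_nonneg (hFb _ hz).1]
    simpa [abs_of_nonneg hz] using (hFb _ hz).2
  have hA0 : 0 ≤ A := (abs_nonneg _).trans (hf' 0)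
  have bddL : ∀ {w : SpaceTime m → ℝ}, LocallyIntegrable w (muS m) →
      LocallyIntegrable (fun z => f' (u z) * w z) (muS m) := fun {w} hw => by
    refine (hw.smul A).mono (hf'um.mul hw.aestronglyMeasurable) (ae_of_all _ fun z => ?_)
    simp only [Pi.smul_apply, smul_eq_mul, norm_mul, Real.norm_eq_abs, abs_of_nonneg hA0]
    gcongr
    exact hf' _
  have hinL : ∀ v : Space m, LocallyIntegrable (fun z => inner ℝ (Gu z) v) (muS m) := fun v => by
    have hGn : MemLpLoc (fun z => ‖Gu z‖) p := fun K hK => (hu.memLp_grad K hK).norm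
    refine ((hGn.locallyIntegrable hp.le).smul ‖v‖).mono
      (hGL.aestronglyMeasurable.inner aestronglyMeasurable_const) (ae_of_all _ fun z => ?_)
    simpa [mul_comm] using norm_inner_le_norm (𝕜 := ℝ) (Gu z) v
  obtain ⟨N, hN0, hN⟩ := exists_abs_le_of_hasCompactSupport hφ.continuous hφc
  set e : SpaceTime m := (0, 1)
  set w : SpaceTime m → ℝ := fun z => f' (u z) * wu z * φ z + f (u z) * fderiv ℝ φ z e with hw
  have hdtc := continuous_fderiv_apply hφ e
  have hdts := hasCompactSupport_fderiv_apply hφc e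
  -- the product rule, in space and in time
  have prodS : ∀ (v : Space m) {θ : SpaceTime m → ℝ}, ContDiff ℝ ∞ θ →
      ∫ z, (f (u z) * φ z) * fderiv ℝ θ z (v, 0) ∂(muS m)
        = -∫ z, (f' (u z) * inner ℝ (Gu z) v * φ z + f (u z) * fderiv ℝ φ z (v, 0)) * θ z
          ∂(muS m) := fun v θ hθ =>
    ((hu.derivs.hasWeakDirDeriv_space v).comp (isOpen_upper m) huL (hinL v) hf hf'c
      hf').integral_mul_smooth hfuL (bddL (hinL v)) hφ hφc hφU hθ
  have prodT : ∀ {θ : SpaceTime m → ℝ}, ContDiff ℝ ∞ θ →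
      ∫ z, (f (u z) * φ z) * fderiv ℝ θ z e ∂(muS m) = -∫ z, w z * θ z ∂(muS m) := fun {θ} hθ =>
    (hu.derivs.hasWeakDirDeriv_time.comp (isOpen_upper m) huL hwL hf hf'c
      hf').integral_mul_smooth hfuL (bddL hwL) hφ hφc hφU hθ
  have hK : IsCompact (tsupport φ) := hφc
  have hφK : ∀ z ∉ tsupport φ, φ z = 0 := fun z hz => image_eq_zero_of_notMem_tsupport hz
  have hdK : ∀ z ∉ tsupport φ, fderiv ℝ φ z = 0 := fun z hz =>
    image_eq_zero_of_notMem_tsupport (fun h => hz (tsupport_fderiv_subset ℝ h))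
  obtain ⟨N', hN'⟩ : ∃ N', ∀ z, ‖spatialGradient φ z‖ ≤ N' :=
    (HasCompactSupport.intro hK fun z hz =>
      spatialGradient_of_notMem_tsupport hz).exists_bound_of_continuous
      (continuous_spatialGradient hφ)
  obtain ⟨N'', -, hN''⟩ := exists_abs_le_of_hasCompactSupport hdtc hdts
  have hfφ : ∀ᵐ z ∂(muS m), |f' (u z) * φ z| ≤ A * N := ae_of_all _ fun z => by
    rw [abs_mul]
    exact mul_le_mul (hf' _) (hN z) (abs_nonneg _) hA0
  have m1 : AEStronglyMeasurable (fun z => f (u z) * φ z) (muS m) :=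
    hfum.mul hφ.continuous.aestronglyMeasurable
  have m2 : AEStronglyMeasurable (fun z => f' (u z) * φ z) (muS m) :=
    hf'um.mul hφ.continuous.aestronglyMeasurable
  have m3 : AEStronglyMeasurable (fun z => f (u z) • spatialGradient φ z) (muS m) :=
    hfum.smul (continuous_spatialGradient hφ).aestronglyMeasurable
  have hψ : IsTestFunction p (fun z => f (u z) * φ z)
      (fun z => (f' (u z) * φ z) • Gu z + f (u z) • spatialGradient φ z) w (fun _ => 0) := by
    refine ⟨⟨?_, ?_, ?_, ⟨fun θ hθ _ _ v => ?_, fun θ hθ _ _ => prodT hθ⟩⟩,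
      ⟨locallyIntegrable_const 0, fun θ hθ hθc => ?_⟩, ?_, ⟨tsupport φ, hφc, ?_⟩⟩
    · refine memLp_muS_of_bound hK m1 (C := 2 * N) ?_
        (fun z hz => by simp [hφK z hz]) _
      filter_upwards [hfub] with z hz
      rw [norm_mul]
      exact mul_le_mul hz (hN z) (abs_nonneg _) zero_le_two
    · refine (hu.memLp_grad.memLp_smul hK m2 hfφ
        (fun z hz => by simp [hφK z hz])).add (memLp_muS_of_bound hK
          m3 (C := 2 * N') ?_
          (fun z hz => by simp [spatialGradient_of_notMem_tsupport hz]) _)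
      filter_upwards [hfub] with z hz
      rw [norm_smul]
      exact mul_le_mul hz (hN' z) (norm_nonneg _) zero_le_two
    · have h1 := hu.memLp_time.memLp_smul hK m2 hfφ
        (fun z hz => by simp [hφK z hz])
      have h2 := memLp_muS_of_bound (g := fun z => f (u z) * fderiv ℝ φ z e) hK
        (hfum.mul hdtc.aestronglyMeasurable) (C := 2 * N'')
        (by
          filter_upwards [hfub] with z hz
          rw [norm_mul]
          exact mul_le_mul hz (hN'' z) (norm_nonneg _) zero_le_two)
        (fun z hz => by simp [hdK z hz]) (ENNReal.ofReal p)
      refine (h1.add h2).ae_eq (ae_of_all _ fun z => ?_)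
      simp only [Pi.add_apply, smul_eq_mul, hw]
      ring
    · rw [prodS v hθ]
      refine congrArg _ (integral_congr_ae (ae_of_all _ fun z => ?_))
      simp only [inner_add_left, real_inner_smul_left, inner_spatialGradient]
      ring
    · have j1 : Integrable (fun z => f (u z) * φ z * fderiv ℝ θ z e) (muS m) := by
        simp_rw [mul_assoc]
        exact hfuL.integrable_mul_of_hasCompactSupport
          (hφ.continuous.mul (continuous_fderiv_apply hθ e)) hφc.mul_right
      have j2 : Integrable (fun z => w z * θ z) (muS m) := by
        simp_rw [hw, add_mul, mul_assoc _ _ (θ _)]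
        exact ((bddL hwL).integrable_mul_of_hasCompactSupport
          (hφ.continuous.mul hθ.continuous) hφc.mul_right).add
          (hfuL.integrable_mul_of_hasCompactSupport (hdtc.mul hθ.continuous) hdts.mul_right)
      rw [integral_add j1 j2, prodT hθ]
      simp
    · filter_upwards [hu0] with z hz
      exact mul_nonneg (by linarith [(hfb _ hz).1]) (hφ0 z)
    · exact ae_of_all _ fun z hz => by simp [hφK z hz]
  -- the chain rule for the function `s f(s) - F(s)`, whose derivative is `s f'(s)`
  have hchain := hu.derivs.hasWeakDirDeriv_time.comp (isOpen_upper m) huL hwL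
    (f := fun s => s * f s - F s) (f' := fun s => s * f' s)
    (fun s => (((hasDerivAt_id s).mul (hf s)).sub (hF s)).congr_deriv (by simp))
    (continuous_id.mul hf'c) hsf' φ hφ hφc hφU
  change ∫ z, (u z * f (u z) - F (u z)) * fderiv ℝ φ z e ∂(muS m)
    = -∫ z, u z * f' (u z) * wu z * φ z ∂(muS m) at hchain
  have hufL : LocallyIntegrable (fun z => u z * f (u z)) (muS m) := by
    refine (huL.smul (2 : ℝ)).mono (hum.mul hfum) ?_
    filter_upwards [hfub] with z hz
    simp only [Pi.smul_apply, smul_eq_mul, norm_mul, Real.norm_eq_abs, abs_two]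
    rw [mul_comm]
    gcongr
  have hA'0 : 0 ≤ A' := (abs_nonneg _).trans (hsf' 0)
  have hsL : LocallyIntegrable (fun z => u z * f' (u z) * wu z) (muS m) := by
    refine (hwL.smul A').mono ((hum.mul hf'um).mul hwL.aestronglyMeasurable)
      (ae_of_all _ fun z => ?_)
    simp only [Pi.smul_apply, smul_eq_mul, norm_mul, Real.norm_eq_abs]
    rw [← abs_mul, abs_of_nonneg hA'0]
    exact mul_le_mul_of_nonneg_right (hsf' _) (abs_nonneg _)
  have i1 : Integrable (fun z => u z * f' (u z) * wu z * φ z) (muS m) :=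
    hsL.integrable_mul_of_hasCompactSupport hφ.continuous hφc
  have i2 : Integrable (fun z => u z * f (u z) * fderiv ℝ φ z e) (muS m) :=
    hufL.integrable_mul_of_hasCompactSupport hdtc hdts
  have i3 : Integrable (fun z => F (u z) * fderiv ℝ φ z e) (muS m) :=
    hFuL.integrable_mul_of_hasCompactSupport hdtc hdts
  have huw : (fun z => u z * w z)
      = fun z => u z * f' (u z) * wu z * φ z + u z * f (u z) * fderiv ℝ φ z e := by
    funext z
    simp only [hw]
    ring
  have htime : ∫ z, u z * w z ∂(muS m) = ∫ z, F (u z) * fderiv ℝ φ z e ∂(muS m) := by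
    simp_rw [sub_mul] at hchain
    rw [integral_sub i2 i3] at hchain
    rw [huw, integral_add i1 i2]
    linarith
  have iq : Integrable (fun z => u z ^ q * φ z) (muS m) := by
    refine ((locallyIntegrable_iff.2 huq).integrable_mul_of_hasCompactSupport hφ.continuous
      hφc).congr ?_
    filter_upwards [hu0] with z hz
    rw [abs_of_nonneg hz]
  have iψ : Integrable (fun z => f (u z) * φ z * u z ^ q * 1) (muS m) := by
    refine (iq.bdd_mul (c := 2) hfum hfub).congr (ae_of_all _ fun z => ?_)
    ring
  have key := hweak _ _ w (fun _ => 0) hψ iψ (by rw [huw]; exact i1.add i2) (by simp)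
  rw [htime] at key
  simp only [mul_zero, integral_zero, sub_zero] at key
  refine le_trans (integral_mono_ae iq iψ ?_) key
  filter_upwards [hu0] with z hz
  have h1 : 0 ≤ u z ^ q * φ z := mul_nonneg (Real.rpow_nonneg hz q) (hφ0 z)
  nlinarith [(hfb _ hz).1]

/-! ### Anisotropic cutoffs -/

/-- The fixed cutoff on space-time, `1` on the unit ball and supported in the ball of radius `2`
(for the maximum of the norms of the two components). -/
noncomputable def baseCutoff (m : ℕ) : ContDiffBump (0 : SpaceTime m) where
  rIn := 1
  rOut := 2
  rIn_pos := one_pos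
  rIn_lt_rOut := one_lt_two

/-- The anisotropic scaling `(x, t) ↦ (x / R, t / Θ)`. -/
noncomputable def scaling {m : ℕ} (R Θ : ℝ) : SpaceTime m →L[ℝ] SpaceTime m :=
  (R⁻¹ • ContinuousLinearMap.fst ℝ (Space m) ℝ).prod (Θ⁻¹ • ContinuousLinearMap.snd ℝ (Space m) ℝ)

theorem scaling_apply {m : ℕ} (R Θ : ℝ) (z : SpaceTime m) :
    scaling R Θ z = (R⁻¹ • z.1, Θ⁻¹ * z.2) := rfl

/-- The cutoff `ξ` at scale `R` in space and `Θ` in time. -/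
noncomputable def scaledCutoff {m : ℕ} (R Θ : ℝ) (z : SpaceTime m) : ℝ :=
  baseCutoff m (scaling R Θ z)

/-- A smooth nondecreasing function of time which vanishes for `t ≤ δ` and is positive for `t > δ`.
It keeps test functions away from `t = 0`. -/
noncomputable def ramp (δ t : ℝ) : ℝ := Real.smoothTransition (t / δ - 1)

/-- The cutoff `ξ ^ k * η` used in the test functions. -/
noncomputable def cutoff {m : ℕ} (k : ℕ) (R Θ δ : ℝ) (z : SpaceTime m) : ℝ :=
  scaledCutoff R Θ z ^ k * ramp δ z.2

theorem ramp_nonneg (δ t : ℝ) : 0 ≤ ramp δ t := Real.smoothTransition.nonneg _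

theorem ramp_le_one (δ t : ℝ) : ramp δ t ≤ 1 := Real.smoothTransition.le_one _

theorem ramp_pos {δ t : ℝ} (hδ : 0 < δ) (ht : δ < t) : 0 < ramp δ t :=
  Real.smoothTransition.pos_of_pos (by rw [sub_pos, one_lt_div hδ]; exact ht)

theorem ramp_eq_zero {δ t : ℝ} (hδ : 0 < δ) (ht : t ≤ δ) : ramp δ t = 0 :=
  Real.smoothTransition.zero_of_nonpos (by rw [sub_nonpos, div_le_one hδ]; exact ht)

theorem contDiff_ramp (δ : ℝ) : ContDiff ℝ ∞ (ramp δ) :=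
  Real.smoothTransition.contDiff.comp ((contDiff_id.div_const δ).sub contDiff_const)

theorem deriv_ramp_nonneg {δ : ℝ} (hδ : 0 < δ) (t : ℝ) : 0 ≤ deriv (ramp δ) t := by
  refine Monotone.deriv_nonneg fun a b hab => Real.smoothTransition.monotone ?_
  gcongr

section Cutoff

variable {m : ℕ} {R Θ : ℝ}

theorem scaledCutoff_nonneg (z : SpaceTime m) : 0 ≤ scaledCutoff R Θ z := (baseCutoff m).nonneg

theorem scaledCutoff_le_one (z : SpaceTime m) : scaledCutoff R Θ z ≤ 1 := (baseCutoff m).le_one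

theorem scaledCutoff_eq_one {z : SpaceTime m} (hz : ‖scaling R Θ z‖ ≤ 1) :
    scaledCutoff R Θ z = 1 :=
  (baseCutoff m).one_of_mem_closedBall (by simpa [baseCutoff] using hz)

theorem scaledCutoff_eq_zero {z : SpaceTime m} (hz : 2 ≤ ‖scaling R Θ z‖) :
    scaledCutoff R Θ z = 0 :=
  (baseCutoff m).zero_of_le_dist (by simpa [baseCutoff] using hz)

theorem contDiff_scaledCutoff : ContDiff ℝ ∞ (scaledCutoff R Θ : SpaceTime m → ℝ) :=
  (baseCutoff m).contDiff.comp (scaling R Θ).contDiff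

theorem fderiv_scaledCutoff_eq_zero {z : SpaceTime m}
    (hz : ‖scaling R Θ z‖ < 1 ∨ 2 < ‖scaling R Θ z‖) : fderiv ℝ (scaledCutoff R Θ) z = 0 := by
  have hc : Continuous fun z : SpaceTime m => ‖scaling R Θ z‖ := (scaling R Θ).continuous.norm
  have : ∃ c : ℝ, scaledCutoff R Θ =ᶠ[𝓝 z] fun _ => c := by
    rcases hz with hz | hz
    · exact ⟨1, ((hc.tendsto z).eventually_lt_const hz).mono fun y hy => scaledCutoff_eq_one hy.le⟩
    · exact ⟨0, ((hc.tendsto z).eventually_const_lt hz).mono fun y hy =>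
        scaledCutoff_eq_zero hy.le⟩
  obtain ⟨c, hcz⟩ := this
  rw [hcz.fderiv_eq]
  simp

theorem exists_fderiv_scaledCutoff_le (m : ℕ) : ∃ M : ℝ, 0 ≤ M ∧ ∀ R Θ : ℝ, 0 < R → 0 < Θ →
    ∀ z : SpaceTime m, (∀ v : Space m, |fderiv ℝ (scaledCutoff R Θ) z (v, 0)| ≤ M / R * ‖v‖) ∧
      |fderiv ℝ (scaledCutoff R Θ) z (0, 1)| ≤ M / Θ := by
  have hs : ContDiff ℝ ∞ (baseCutoff m) := (baseCutoff m).contDiff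
  obtain ⟨M, hM⟩ := ((baseCutoff m).hasCompactSupport.fderiv ℝ).exists_bound_of_continuous
    (hs.continuous_fderiv (by simp))
  have hM0 : 0 ≤ M := (norm_nonneg _).trans (hM 0)
  refine ⟨M, hM0, fun R Θ hR hΘ z => ?_⟩
  have hd : fderiv ℝ (scaledCutoff R Θ) z
      = (fderiv ℝ (baseCutoff m) (scaling R Θ z)).comp (scaling R Θ) :=
    ((hs.differentiable (by simp) _).hasFDerivAt.comp z (scaling R Θ).hasFDerivAt).fderiv
  have hle : ∀ e, |fderiv ℝ (scaledCutoff R Θ) z e| ≤ M * ‖scaling R Θ e‖ := fun e => by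
    rw [hd]
    exact (ContinuousLinearMap.le_opNorm _ _).trans
      (mul_le_mul_of_nonneg_right (hM _) (norm_nonneg _))
  refine ⟨fun v => (hle _).trans (le_of_eq ?_), (hle _).trans (le_of_eq ?_)⟩
  · have : 0 ≤ R⁻¹ * ‖v‖ := by positivity
    simp [scaling_apply, Prod.norm_def, norm_smul, abs_of_pos hR, max_eq_left this]
    ring
  · simp [scaling_apply, Prod.norm_def, abs_of_pos hΘ, hΘ.le]
    ring

theorem setOf_norm_scaling_le (hR : 0 < R) (hΘ : 0 < Θ) (c : ℝ) :
    {z : SpaceTime m | ‖scaling R Θ z‖ ≤ c}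
      = Metric.closedBall 0 (c * R) ×ˢ Metric.closedBall 0 (c * Θ) := by
  ext ⟨x, t⟩
  simp only [mem_ofPred_eq, scaling_apply, Prod.norm_def, sup_le_iff, norm_smul, norm_mul, norm_inv,
    Real.norm_eq_abs, abs_of_pos hR, abs_of_pos hΘ, mem_prod, mem_closedBall_zero_iff,
    inv_mul_le_iff₀ hR, inv_mul_le_iff₀ hΘ, mul_comm c]

theorem muS_real_le (hR : 0 < R) (hΘ : 0 < Θ) :
    (muS m).real {z | ‖scaling R Θ z‖ ≤ 2}
      ≤ 2 ^ (m + 2) * volume.real (Metric.ball (0 : Space m) 1) * (R ^ m * Θ) := by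
  have hc : volume {z : SpaceTime m | ‖scaling R Θ z‖ ≤ 2} ≠ ⊤ := by
    rw [setOf_norm_scaling_le hR hΘ]
    exact ((isCompact_closedBall _ _).prod (isCompact_closedBall _ _)).measure_lt_top.ne
  calc (muS m).real {z | ‖scaling R Θ z‖ ≤ 2}
      ≤ volume.real {z : SpaceTime m | ‖scaling R Θ z‖ ≤ 2} :=
        ENNReal.toReal_mono hc (Measure.restrict_apply_le _ _)
    _ = _ := by
      rw [setOf_norm_scaling_le hR hΘ, Measure.volume_eq_prod, measureReal_prod_prod,
        Measure.addHaar_real_closedBall _ _ (by positivity),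
        Real.volume_real_closedBall (by positivity)]
      simp only [finrank_euclideanSpace, Fintype.card_fin]
      rw [mul_pow, pow_add]
      ring

variable {k : ℕ} {δ : ℝ}

theorem contDiff_cutoff : ContDiff ℝ ∞ (cutoff k R Θ δ : SpaceTime m → ℝ) :=
  (contDiff_scaledCutoff.pow k).mul ((contDiff_ramp δ).comp contDiff_snd)

theorem cutoff_nonneg (z : SpaceTime m) : 0 ≤ cutoff k R Θ δ z :=
  mul_nonneg (pow_nonneg (scaledCutoff_nonneg z) k) (ramp_nonneg δ z.2)

theorem tsupport_cutoff_subset (hk : k ≠ 0) (hδ : 0 < δ) :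
    tsupport (cutoff k R Θ δ : SpaceTime m → ℝ) ⊆ {z | ‖scaling R Θ z‖ ≤ 2} ∩ {z | δ ≤ z.2} := by
  refine closure_minimal (fun z hz => ⟨?_, ?_⟩)
    ((isClosed_le (scaling R Θ).continuous.norm continuous_const).inter
      (isClosed_le continuous_const continuous_snd))
  · by_contra h
    exact hz (by simp [cutoff, scaledCutoff_eq_zero (not_le.1 h).le, hk])
  · by_contra h
    exact hz (by simp [cutoff, ramp_eq_zero hδ (not_le.1 h).le])

theorem hasCompactSupport_cutoff (hR : 0 < R) (hΘ : 0 < Θ) (hk : k ≠ 0) (hδ : 0 < δ) :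
    HasCompactSupport (cutoff k R Θ δ : SpaceTime m → ℝ) := by
  have h := (tsupport_cutoff_subset (m := m) (R := R) (Θ := Θ) hk hδ).trans inter_subset_left
  rw [setOf_norm_scaling_le hR hΘ] at h
  exact ((isCompact_closedBall _ _).prod (isCompact_closedBall _ _)).of_isClosed_subset
    (isClosed_tsupport _) h

theorem fderiv_cutoff (z e : SpaceTime m) :
    fderiv ℝ (cutoff k R Θ δ) z e
      = k * scaledCutoff R Θ z ^ (k - 1) * fderiv ℝ (scaledCutoff R Θ) z e * ramp δ z.2
        + scaledCutoff R Θ z ^ k * (deriv (ramp δ) z.2 * e.2) := by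
  have h1 := (contDiff_scaledCutoff (m := m) (R := R) (Θ := Θ)).differentiable (by simp) z
    |>.hasFDerivAt.pow k
  have h2 : HasFDerivAt (fun z : SpaceTime m => ramp δ z.2) _ z :=
    (((contDiff_ramp δ).differentiable (by simp) z.2).hasDerivAt).comp_hasFDerivAt z
      (hasFDerivAt_snd (𝕜 := ℝ) (p := z))
  have h3 : HasFDerivAt (cutoff k R Θ δ) _ z := h1.mul h2
  rw [h3.fderiv]
  simp
  ring

end Cutoff

/-! ### The a priori estimate -/

theorem integral_le_of_ae_le {α : Type*} [MeasurableSpace α] {μ : Measure α} {g h : α → ℝ}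
    (hh : Integrable h μ) (h0 : ∀ x, 0 ≤ h x) (hgh : ∀ᵐ x ∂μ, g x ≤ h x) :
    ∫ x, g x ∂μ ≤ ∫ x, h x ∂μ := by
  by_cases hg : Integrable g μ
  · exact integral_mono_ae hg hh hgh
  · rw [integral_undef hg]
    exact integral_nonneg h0

theorem one_add_rpow_mul_rpow_le {a q r y ξ : ℝ} {k : ℕ} (ha : 0 ≤ a) (haq : a ≤ q) (hq : 0 < q)
    (hr : k * (a / q) ≤ r) (hr0 : 0 ≤ r) (hy : 0 ≤ y) (hξ0 : 0 ≤ ξ) (hξ1 : ξ ≤ 1) :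
    (1 + y) ^ a * ξ ^ r ≤ 2 ^ a * (2 + y ^ q * ξ ^ k) := by
  have h1 : (1 + y) ^ a ≤ 2 ^ a * (1 + y ^ a) := by
    have hya : 0 ≤ y ^ a := by positivity
    rcases le_total y 1 with h | h
    · calc (1 + y) ^ a ≤ 2 ^ a := by
            apply Real.rpow_le_rpow <;> linarith
        _ ≤ _ := le_mul_of_one_le_right (by positivity) (by linarith)
    · calc (1 + y) ^ a ≤ (2 * y) ^ a := by
            apply Real.rpow_le_rpow <;> linarith
        _ = 2 ^ a * y ^ a := Real.mul_rpow (by norm_num) hy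
        _ ≤ _ := by gcongr; linarith
  have h2 := rpow_mul_rpow_le ha haq hq hr hy hξ0 hξ1
  have h3 : ξ ^ r ≤ 1 := Real.rpow_le_one hξ0 hξ1 hr0
  calc (1 + y) ^ a * ξ ^ r ≤ 2 ^ a * (1 + y ^ a) * ξ ^ r := by gcongr
    _ = 2 ^ a * (ξ ^ r + y ^ a * ξ ^ r) := by ring
    _ ≤ 2 ^ a * (1 + (1 + y ^ q * ξ ^ k)) := by gcongr
    _ = _ := by ring

set_option maxHeartbeats 400000 in
/-- The estimate for `u ^ q` at scale `R` in space, `Θ` in time and `T` in the values of `u`.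
The factor in front of the integral on the right becomes small for a suitable choice of `T`, and
that integral only extends over the region where the cutoff `ξ` is not constant. -/
theorem IsWeakSolution.integral_cutoff_le {m : ℕ} {p q : ℝ} (hp : 1 < p) (hq : 1 < q)
    {u₀ : Space m → ℝ} {u : SpaceTime m → ℝ} (hu : IsWeakSolution p q (fun _ => 1) u₀ u)
    {α a : ℝ} (hα : 0 < α) (haα : a = (α + 1) * (p - 1)) (haq : a ≤ q) {k : ℕ}
    (hkp : p ≤ k) (hka : k * (a / q) ≤ k - p) (hk1 : k * (1 / q) ≤ k - 1) :
    ∃ C : ℝ, 0 ≤ C ∧ ∀ R Θ T δ : ℝ, 0 < R → 0 < Θ → 0 < T → 0 < δ →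
      ∫ z, u z ^ q * cutoff k R Θ δ z ∂(muS m) ≤
        C * (R ^ (-p) * T ^ (p - 1) + T / Θ) * (R ^ m * Θ
          + T ^ (-q) * ∫ z in {z | 1 ≤ ‖scaling R Θ z‖}, u z ^ q * cutoff k R Θ δ z ∂(muS m)) := by
  obtain ⟨Gu, wu, hmem, huq, hu0, hweak⟩ := hu
  simp only [mul_one] at huq
  obtain ⟨M, hM0, hM⟩ := exists_fderiv_scaledCutoff_le m
  have ha0 : 0 ≤ a := by rw [haα]; have : 0 < p - 1 := by linarith
                         positivity
  have hk2 : 1 < k := by exact_mod_cast hp.trans_le hkp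
  have hk0 : k ≠ 0 := by omega
  set C₁ : ℝ := 2 ^ p * (k * M) ^ p * α ^ (1 - p) * 2 ^ a with hC₁
  have hC₁0 : 0 ≤ C₁ := by positivity
  set vol : ℝ := 2 ^ (m + 2) * volume.real (Metric.ball (0 : Space m) 1)
  have hvol0 : 0 ≤ vol := by positivity
  refine ⟨(C₁ + 2 * k * M) * (2 * vol + 1), by positivity, fun R Θ T δ hR hΘ hT hδ => ?_⟩
  obtain ⟨f, f', F, hf, hf'c, hf', hsf', hF, hfb, hFb, hf'e⟩ := exists_multiplier hα hT
  have hφc : HasCompactSupport (cutoff k R Θ δ : SpaceTime m → ℝ) :=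
    hasCompactSupport_cutoff hR hΘ hk0 hδ
  have key := energy_inequality hp hmem huq hu0 hweak hf hf'c hf' hsf' hF hfb hFb
    contDiff_cutoff hφc ((tsupport_cutoff_subset hk0 hδ).trans fun z hz => lt_of_lt_of_le hδ hz.2)
    cutoff_nonneg
  set A : Set (SpaceTime m) := {z | 1 ≤ ‖scaling R Θ z‖}
  set B : Set (SpaceTime m) := {z | ‖scaling R Θ z‖ ≤ 2} with hB
  have hAm : MeasurableSet A :=
    (isClosed_le continuous_const (scaling R Θ).continuous.norm).measurableSet
  have hBc : IsCompact B := by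
    rw [hB, setOf_norm_scaling_le hR hΘ]
    exact (isCompact_closedBall _ _).prod (isCompact_closedBall _ _)
  have hBm : MeasurableSet B := hBc.measurableSet
  have iq : Integrable (fun z => u z ^ q * cutoff k R Θ δ z) (muS m) := by
    refine ((locallyIntegrable_iff.2 huq).integrable_mul_of_hasCompactSupport
      contDiff_cutoff.continuous hφc).congr ?_
    filter_upwards [hu0] with z hz
    rw [abs_of_nonneg hz]
  -- the common majorant of both terms on the right; absolute values make it nonnegative everywhere
  set H : SpaceTime m → ℝ := fun z => 2 * B.indicator (fun _ => 1) z
    + T ^ (-q) * A.indicator (fun z => |u z ^ q * cutoff k R Θ δ z|) z with hH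
  have hH0 : ∀ z, 0 ≤ H z := fun z => by
    have h1 : 0 ≤ B.indicator (fun _ => (1 : ℝ)) z := indicator_nonneg (fun _ _ => zero_le_one) z
    have h2 : 0 ≤ A.indicator (fun z => |u z ^ q * cutoff k R Θ δ z|) z :=
      indicator_nonneg (fun _ _ => abs_nonneg _) z
    have h3 : 0 < T ^ (-q) := by positivity
    simp only [hH]
    positivity
  have iB : Integrable (B.indicator fun _ => (1 : ℝ)) (muS m) :=
    (integrable_indicator_iff hBm).2 (integrableOn_const hBc.measure_lt_top.ne)
  have iH : Integrable H (muS m) := (iB.const_mul 2).add ((iq.abs.indicator hAm).const_mul _)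
  have hHint : ∫ z, H z ∂(muS m) = 2 * (muS m).real B
      + T ^ (-q) * ∫ z in A, u z ^ q * cutoff k R Θ δ z ∂(muS m) := by
    rw [hH, integral_add (iB.const_mul 2) ((iq.abs.indicator hAm).const_mul _), integral_const_mul,
      integral_const_mul, integral_indicator hAm, integral_indicator hBm]
    congr 2
    · simp
    · refine integral_congr_ae (ae_restrict_of_ae ?_)
      filter_upwards [hu0] with z hz
      exact abs_of_nonneg (mul_nonneg (Real.rpow_nonneg hz q) (cutoff_nonneg z))
  -- on the region where the cutoff varies, `H` has a simple form
  have hHAB : ∀ z ∈ A ∩ B, 0 ≤ u z →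
      (2 + (u z / T) ^ q * scaledCutoff R Θ z ^ k) * ramp δ z.2 ≤ H z := fun z hz huz => by
    simp only [hH, indicator_of_mem hz.1, indicator_of_mem hz.2]
    rw [abs_of_nonneg (mul_nonneg (Real.rpow_nonneg huz q) (cutoff_nonneg z)),
      Real.div_rpow huz hT.le, div_eq_mul_inv, ← Real.rpow_neg hT.le, cutoff]
    nlinarith [ramp_le_one δ z.2]
  have hder0 : ∀ z, z ∉ A ∩ B → fderiv ℝ (scaledCutoff R Θ) z = 0 := fun z hz => by
    refine fderiv_scaledCutoff_eq_zero ?_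
    by_contra h
    push Not at h
    exact hz ⟨h.1, h.2⟩
  have flux : ∫ z, ‖Gu z‖ ^ (p - 2) * inner ℝ (Gu z)
      ((f' (u z) * cutoff k R Θ δ z) • Gu z + f (u z) • spatialGradient (cutoff k R Θ δ) z) ∂(muS m)
      ≤ C₁ * (R ^ (-p) * T ^ (p - 1)) * ∫ z, H z ∂(muS m) := by
    rw [← integral_const_mul]
    refine integral_le_of_ae_le (iH.const_mul _) (fun z => mul_nonneg (by positivity) (hH0 z)) ?_
    filter_upwards [hu0] with z huz
    have hξ0 := scaledCutoff_nonneg (R := R) (Θ := Θ) z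
    have hη0 := ramp_nonneg δ z.2
    have hy : 0 ≤ u z / T := by positivity
    set β : ℝ := α / T * (1 + u z / T) ^ (-α - 1) with hβ
    have hβ0 : 0 < β := by positivity
    have hgrad : ∀ v : Space m, fderiv ℝ (cutoff k R Θ δ) z (v, 0)
        = k * scaledCutoff R Θ z ^ (k - 1) * fderiv ℝ (scaledCutoff R Θ) z (v, 0) * ramp δ z.2 :=
      fun v => by rw [fderiv_cutoff]; simp
    rw [hf'e _ huz, ← hβ]
    by_cases hz : z ∈ A ∩ B
    · have hD : ‖spatialGradient (cutoff k R Θ δ) z‖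
          ≤ (k * M / R) * scaledCutoff R Θ z ^ (k - 1) * ramp δ z.2 := by
        refine norm_spatialGradient_le (by positivity) fun v => ?_
        rw [hgrad, abs_mul, abs_mul, abs_of_nonneg hη0,
          abs_of_nonneg (by positivity : 0 ≤ k * scaledCutoff R Θ z ^ (k - 1))]
        calc _ ≤ k * scaledCutoff R Θ z ^ (k - 1) * (M / R * ‖v‖) * ramp δ z.2 := by
              gcongr
              exact (hM R Θ hR hΘ z).1 v
          _ = _ := by ring
      refine (flux_le hp hkp hβ0 (hfb _ huz).1 (hfb _ huz).2 hξ0 hη0 (by positivity) hD).trans ?_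
      have hβp : β ^ (1 - p) = α ^ (1 - p) * T ^ (p - 1) * (1 + u z / T) ^ a := by
        rw [hβ, Real.mul_rpow (by positivity) (by positivity), ← Real.rpow_mul (by positivity),
          Real.div_rpow hα.le hT.le, div_eq_mul_inv, ← Real.rpow_neg hT.le, neg_sub, haα]
        congr 2
        ring
      have hN : (k * M / R) ^ p = (k * M) ^ p * R ^ (-p) := by
        rw [Real.div_rpow (by positivity) hR.le, div_eq_mul_inv, ← Real.rpow_neg hR.le]
      have hw := one_add_rpow_mul_rpow_le ha0 haq (by linarith) hka (by linarith) hy hξ0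
        (scaledCutoff_le_one z)
      calc 2 ^ p * (k * M / R) ^ p * β ^ (1 - p) * scaledCutoff R Θ z ^ ((k : ℝ) - p) * ramp δ z.2
          = 2 ^ p * (k * M) ^ p * α ^ (1 - p) * (R ^ (-p) * T ^ (p - 1))
            * ((1 + u z / T) ^ a * scaledCutoff R Θ z ^ ((k : ℝ) - p)) * ramp δ z.2 := by
            rw [hβp, hN]; ring
        _ ≤ 2 ^ p * (k * M) ^ p * α ^ (1 - p) * (R ^ (-p) * T ^ (p - 1))
            * (2 ^ a * (2 + (u z / T) ^ q * scaledCutoff R Θ z ^ k)) * ramp δ z.2 := by gcongr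
        _ = C₁ * (R ^ (-p) * T ^ (p - 1))
            * ((2 + (u z / T) ^ q * scaledCutoff R Θ z ^ k) * ramp δ z.2) := by rw [hC₁]; ring
        _ ≤ _ := by
          gcongr
          exact hHAB z hz huz
    · have hD : ‖spatialGradient (cutoff k R Θ δ) z‖
          ≤ 0 * scaledCutoff R Θ z ^ (k - 1) * ramp δ z.2 := by
        simp only [zero_mul]
        refine norm_spatialGradient_le le_rfl fun v => ?_
        rw [hgrad, hder0 z hz]
        simp
      refine (flux_le hp hkp hβ0 (hfb _ huz).1 (hfb _ huz).2 hξ0 hη0 le_rfl hD).trans ?_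
      rw [Real.zero_rpow (by linarith)]
      have := hH0 z
      simp only [mul_zero, zero_mul]
      positivity
  have time : -∫ z, F (u z) * fderiv ℝ (cutoff k R Θ δ) z (0, 1) ∂(muS m)
      ≤ 2 * k * M * (T / Θ) * ∫ z, H z ∂(muS m) := by
    rw [← integral_neg, ← integral_const_mul]
    refine integral_le_of_ae_le (iH.const_mul _) (fun z => mul_nonneg (by positivity) (hH0 z)) ?_
    filter_upwards [hu0] with z huz
    have hξ0 := scaledCutoff_nonneg (R := R) (Θ := Θ) z
    have hη0 := ramp_nonneg δ z.2
    have hy : 0 ≤ u z / T := by positivity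
    obtain ⟨hF0, hF2⟩ := hFb _ huz
    -- the term with the derivative of the ramp has the good sign
    have hgood : 0 ≤ F (u z) * (scaledCutoff R Θ z ^ k * (deriv (ramp δ) z.2 * 1)) := by
      have := deriv_ramp_nonneg hδ z.2
      positivity
    have hle : -(F (u z) * fderiv ℝ (cutoff k R Θ δ) z (0, 1))
        ≤ F (u z) * (k * scaledCutoff R Θ z ^ (k - 1)
          * |fderiv ℝ (scaledCutoff R Θ) z (0, 1)| * ramp δ z.2) := by
      rw [fderiv_cutoff]
      have h1 := mul_le_mul_of_nonneg_left (neg_le_abs (fderiv ℝ (scaledCutoff R Θ) z (0, 1)))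
        (by positivity : 0 ≤ F (u z) * (k * scaledCutoff R Θ z ^ (k - 1) * ramp δ z.2))
      nlinarith [h1, hgood]
    refine hle.trans ?_
    by_cases hz : z ∈ A ∩ B
    · have hw := rpow_mul_rpow_le (a := 1) (r := (k : ℝ) - 1) zero_le_one hq.le (by linarith) hk1 hy
        hξ0 (scaledCutoff_le_one z)
      rw [Real.rpow_one, show (k : ℝ) - 1 = ((k - 1 : ℕ) : ℝ) by push_cast [hk2.le]; ring,
        Real.rpow_natCast] at hw
      calc _ ≤ (2 * u z) * (k * scaledCutoff R Θ z ^ (k - 1) * (M / Θ) * ramp δ z.2) := by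
            gcongr
            exact (hM R Θ hR hΘ z).2
        _ = 2 * k * M * (T / Θ) * ((u z / T * scaledCutoff R Θ z ^ (k - 1)) * ramp δ z.2) := by
            field_simp
        _ ≤ 2 * k * M * (T / Θ)
            * ((2 + (u z / T) ^ q * scaledCutoff R Θ z ^ k) * ramp δ z.2) := by
            gcongr
            linarith
        _ ≤ _ := by
          gcongr
          exact hHAB z hz huz
    · rw [hder0 z hz]
      have := hH0 z
      simp only [_root_.zero_apply, abs_zero, mul_zero, zero_mul]
      positivity
  have hJ0 : 0 ≤ ∫ z in A, u z ^ q * cutoff k R Θ δ z ∂(muS m) := by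
    refine integral_nonneg_of_ae (ae_restrict_of_ae ?_)
    filter_upwards [hu0] with z hz
    exact mul_nonneg (Real.rpow_nonneg hz q) (cutoff_nonneg z)
  set J := ∫ z in A, u z ^ q * cutoff k R Θ δ z ∂(muS m)
  have hB2 := muS_real_le (m := m) hR hΘ
  have hHle : ∫ z, H z ∂(muS m) ≤ (2 * vol + 1) * (R ^ m * Θ + T ^ (-q) * J) := by
    have hbound : ∀ {b v X Y : ℝ}, 0 ≤ v → 0 ≤ X → 0 ≤ Y → b ≤ v * X →
        2 * b + Y ≤ (2 * v + 1) * (X + Y) := fun hv hX hY hb => by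
      nlinarith [mul_nonneg hv hY]
    rw [hHint]
    exact hbound hvol0 (by positivity) (by positivity) hB2
  have hHn : 0 ≤ ∫ z, H z ∂(muS m) := integral_nonneg hH0
  have hx : 0 ≤ R ^ (-p) * T ^ (p - 1) := by positivity
  have hy : 0 ≤ T / Θ := by positivity
  have hkM : 0 ≤ 2 * k * M := by positivity
  calc _ ≤ C₁ * (R ^ (-p) * T ^ (p - 1)) * ∫ z, H z ∂(muS m)
        + 2 * k * M * (T / Θ) * ∫ z, H z ∂(muS m) := by linarith
    _ ≤ (C₁ + 2 * k * M) * (R ^ (-p) * T ^ (p - 1) + T / Θ) * ∫ z, H z ∂(muS m) := by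
      rw [← add_mul]
      gcongr
      nlinarith [mul_nonneg hC₁0 hy, mul_nonneg hkM hx]
    _ ≤ (C₁ + 2 * k * M) * (R ^ (-p) * T ^ (p - 1) + T / Θ)
        * ((2 * vol + 1) * (R ^ m * Θ + T ^ (-q) * J)) := by gcongr
    _ = _ := by ring

/-! ### Passage to the limit -/

/-- The choice of scales: time scale `R ^ (p (q - 1) / s)` and values of `u` of size
`τ * R ^ (-p / s)`, where `s = q - p + 1`. They balance all terms, and the condition `m ≤ p / s` on
the exponent is what makes the constant terms bounded as `R → ∞`. -/
theorem scales_balance {m : ℕ} {p q s R τ : ℝ} (hs : s = q - p + 1) (hs0 : 0 < s)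
    (hm : (m : ℝ) ≤ p / s) (hR : 1 ≤ R) (hτ : 0 < τ) :
    (R ^ (-p) * (τ * R ^ (-p / s)) ^ (p - 1) + τ * R ^ (-p / s) / R ^ (p * (q - 1) / s))
        * (R ^ m * R ^ (p * (q - 1) / s)) ≤ τ ^ (p - 1) + τ ∧
    (R ^ (-p) * (τ * R ^ (-p / s)) ^ (p - 1) + τ * R ^ (-p / s) / R ^ (p * (q - 1) / s))
        * (τ * R ^ (-p / s)) ^ (-q) = τ ^ (p - 1 - q) + τ ^ (1 - q) := by
  have hR0 : 0 < R := by linarith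
  have hT : ∀ r : ℝ, (τ * R ^ (-p / s)) ^ r = τ ^ r * R ^ (-p / s * r) := fun r => by
    rw [Real.mul_rpow hτ.le (by positivity), ← Real.rpow_mul hR0.le]
  have hdiv : ∀ x y : ℝ, τ * R ^ x / R ^ y = τ * R ^ (x - y) := fun x y => by
    rw [Real.rpow_sub hR0, mul_div_assoc]
  have e1 : -p + -p / s * (p - 1) + (m + p * (q - 1) / s) = m - p / s := by
    field_simp; rw [hs]; ring
  have e2 : -p / s - p * (q - 1) / s + (m + p * (q - 1) / s) = m - p / s := by ring
  have e3 : -p + -p / s * (p - 1) + -p / s * -q = 0 := by field_simp; rw [hs]; ring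
  have e4 : -p / s - p * (q - 1) / s + -p / s * -q = 0 := by ring
  have hle : R ^ ((m : ℝ) - p / s) ≤ 1 :=
    Real.rpow_le_one_of_one_le_of_nonpos hR (by linarith)
  rw [hT, hT, hdiv, ← Real.rpow_natCast R m, ← Real.rpow_add hR0]
  constructor
  · calc _ = τ ^ (p - 1) * (R ^ (-p) * R ^ (-p / s * (p - 1)) * R ^ (m + p * (q - 1) / s))
          + τ * (R ^ (-p / s - p * (q - 1) / s) * R ^ (m + p * (q - 1) / s)) := by ring
      _ = τ ^ (p - 1) * R ^ ((m : ℝ) - p / s) + τ * R ^ ((m : ℝ) - p / s) := by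
        rw [← Real.rpow_add hR0, ← Real.rpow_add hR0, ← Real.rpow_add hR0, e1, e2]
      _ ≤ τ ^ (p - 1) * 1 + τ * 1 := by gcongr
      _ = _ := by ring
  · calc _ = τ ^ (p - 1) * τ ^ (-q) * (R ^ (-p) * R ^ (-p / s * (p - 1)) * R ^ (-p / s * -q))
          + τ * τ ^ (-q) * (R ^ (-p / s - p * (q - 1) / s) * R ^ (-p / s * -q)) := by ring
      _ = _ := by
        rw [← Real.rpow_add hR0, ← Real.rpow_add hR0, ← Real.rpow_add hR0, e3, e4,
          Real.rpow_zero, mul_one, mul_one, sub_eq_add_neg (p - 1) q, Real.rpow_add hτ,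
          sub_eq_add_neg 1 q, Real.rpow_add hτ 1, Real.rpow_one]

/-- Choosing the exponent `α` of the multiplier, the power `k` of the cutoff and the scales. -/
theorem IsWeakSolution.integral_le_tail {m : ℕ} (hm : 0 < m) {p q : ℝ} (hp : 1 < p)
    (hq : max 1 (p - 1) < q) (hq' : q ≤ p / (m : ℝ) + p - 1)
    {u₀ : Space m → ℝ} {u : SpaceTime m → ℝ} (hu : IsWeakSolution p q (fun _ => 1) u₀ u) :
    ∃ (k : ℕ) (C θ : ℝ), k ≠ 0 ∧ 0 ≤ C ∧ 0 < θ ∧ ∀ R τ δ : ℝ, 1 ≤ R → 0 < τ → 0 < δ →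
      ∫ z, u z ^ q * cutoff k R (R ^ θ) δ z ∂(muS m) ≤ C * (τ ^ (p - 1) + τ)
        + C * (τ ^ (p - 1 - q) + τ ^ (1 - q))
          * ∫ z in {z | 1 ≤ ‖scaling R (R ^ θ) z‖}, u z ^ q * cutoff k R (R ^ θ) δ z ∂(muS m) := by
  obtain ⟨hq1, hqp⟩ := max_lt_iff.1 hq
  have hp1 : 0 < p - 1 := by linarith
  have hq0 : 0 < q := by linarith
  set a : ℝ := (q + (p - 1)) / 2 with ha
  set α : ℝ := (q - (p - 1)) / (2 * (p - 1)) with hα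
  have hα0 : 0 < α := by
    have : 0 < q - (p - 1) := by linarith
    positivity
  have haα : a = (α + 1) * (p - 1) := by rw [ha, hα]; field_simp; ring
  have haq : a < q := by rw [ha]; linarith
  have h1a : 0 < 1 - a / q := by rw [sub_pos, div_lt_one hq0]; exact haq
  have h1q : 0 < 1 - 1 / q := by rw [sub_pos, div_lt_one hq0]; exact hq1
  obtain ⟨k, hk⟩ := exists_nat_ge (max p (max (p / (1 - a / q)) (1 / (1 - 1 / q))))
  obtain ⟨hkp, hk'⟩ := max_le_iff.1 hk
  obtain ⟨hka, hk1⟩ := max_le_iff.1 hk'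
  rw [div_le_iff₀ h1a] at hka
  rw [div_le_iff₀ h1q] at hk1
  obtain ⟨C, hC, hmain⟩ := hu.integral_cutoff_le hp hq1 hα0 haα haq.le hkp (by linarith)
    (by linarith)
  set s : ℝ := q - p + 1 with hs
  have hs0 : 0 < s := by rw [hs]; linarith
  have hm0 : (0 : ℝ) < m := by exact_mod_cast hm
  have hms : (m : ℝ) ≤ p / s := by
    have h1 : s ≤ p / m := by rw [hs]; linarith
    rw [le_div_iff₀ hm0] at h1
    rw [le_div_iff₀ hs0]
    linarith
  have hk0 : k ≠ 0 := by
    rintro rfl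
    norm_num at hkp
    linarith
  refine ⟨k, C, p * (q - 1) / s, hk0, hC, ?_, fun R τ δ hR hτ hδ => ?_⟩
  · have : 0 < q - 1 := by linarith
    positivity
  have hR0 : 0 < R := by linarith
  obtain ⟨h1, h2⟩ := scales_balance hs hs0 hms hR hτ
  refine (hmain R (R ^ (p * (q - 1) / s)) (τ * R ^ (-p / s)) δ hR0 (by positivity) (by positivity)
    hδ).trans ?_
  set K := R ^ (-p) * (τ * R ^ (-p / s)) ^ (p - 1) + τ * R ^ (-p / s) / R ^ (p * (q - 1) / s)
  have hexpand : ∀ X Y J : ℝ, C * K * (X + Y * J) = C * (K * X) + C * (K * Y) * J := fun X Y J => by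
    ring
  rw [← h2, hexpand]
  gcongr

/-- Removing the cutoff: `u ^ q` is integrable for large times by the estimate with a large
`τ`, so the integrals over the exterior regions vanish in the limit, and then `τ` can be taken
small. -/
theorem IsWeakSolution.ae_eq_zero_of_lt {m : ℕ} (hm : 0 < m) {p q : ℝ} (hp : 1 < p)
    (hq : max 1 (p - 1) < q) (hq' : q ≤ p / (m : ℝ) + p - 1)
    {u₀ : Space m → ℝ} {u : SpaceTime m → ℝ} (hu : IsWeakSolution p q (fun _ => 1) u₀ u)
    {δ : ℝ} (hδ : 0 < δ) : ∀ᵐ z ∂(muS m), δ < z.2 → u z = 0 := by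
  obtain ⟨k, C, θ, hk0, hC, hθ, hmain⟩ := hu.integral_le_tail hm hp hq hq'
  obtain ⟨hq1, hqp⟩ := max_lt_iff.1 hq
  have hq0 : 0 < q := by linarith
  have hu0 : ∀ᵐ z ∂(muS m), 0 ≤ u z := by
    obtain ⟨_, _, _, _, h, _⟩ := hu
    exact h
  have huL : LocallyIntegrable (fun z => u z ^ q) (muS m) := by
    obtain ⟨_, _, _, huq, _, _⟩ := hu
    refine locallyIntegrable_iff.2 fun K hK => (huq K hK).congr (ae_restrict_of_ae ?_)
    filter_upwards [hu0] with z hz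
    rw [abs_of_nonneg hz, mul_one]
  set R : ℕ → ℝ := fun n => (n : ℝ) + 1 with hRdef
  have hR1 : ∀ n, 1 ≤ R n := fun n => by simp [hRdef]
  have hR0 : ∀ n, 0 < R n := fun n => by linarith [hR1 n]
  have hΘ0 : ∀ n, 0 < R n ^ θ := fun n => Real.rpow_pos_of_pos (hR0 n) _
  have hRlim : Tendsto R atTop atTop :=
    tendsto_atTop_add_const_right _ _ tendsto_natCast_atTop_atTop
  set φ : ℕ → SpaceTime m → ℝ := fun n => cutoff k (R n) (R n ^ θ) δ with hφ
  set g : SpaceTime m → ℝ := fun z => u z ^ q * ramp δ z.2 with hg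
  set S : ℕ → Set (SpaceTime m) := fun n => {z | ‖scaling (R n) (R n ^ θ) z‖ < 1} with hS
  have hg0 : ∀ᵐ z ∂(muS m), 0 ≤ g z := by
    filter_upwards [hu0] with z hz
    exact mul_nonneg (Real.rpow_nonneg hz q) (ramp_nonneg _ _)
  have hφg : ∀ n, ∀ᵐ z ∂(muS m), 0 ≤ u z ^ q * φ n z ∧ u z ^ q * φ n z ≤ g z := fun n => by
    filter_upwards [hu0] with z hz
    refine ⟨mul_nonneg (Real.rpow_nonneg hz q) (cutoff_nonneg z),
      mul_le_mul_of_nonneg_left ?_ (Real.rpow_nonneg hz q)⟩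
    exact mul_le_of_le_one_left (ramp_nonneg _ _)
      (pow_le_one₀ (scaledCutoff_nonneg z) (scaledCutoff_le_one z))
  have hφS : ∀ n, ∀ z ∈ S n, u z ^ q * φ n z = g z := fun n z hz => by
    simp only [hφ, hg, cutoff, scaledCutoff_eq_one (le_of_lt hz), one_pow, one_mul]
  have iφ : ∀ n, Integrable (fun z => u z ^ q * φ n z) (muS m) := fun n =>
    huL.integrable_mul_of_hasCompactSupport contDiff_cutoff.continuous
      (hasCompactSupport_cutoff (hR0 n) (hΘ0 n) hk0 hδ)
  have hSm : ∀ n, MeasurableSet (S n) := fun n =>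
    (isOpen_lt (scaling _ _).continuous.norm continuous_const).measurableSet
  have hSc : ∀ n, {z : SpaceTime m | 1 ≤ ‖scaling (R n) (R n ^ θ) z‖} = (S n)ᶜ := fun n => by
    ext z
    simp [hS]
  have cover : AECover (muS m) atTop S := by
    refine ⟨ae_of_all _ fun z => ?_, hSm⟩
    filter_upwards [hRlim.eventually_gt_atTop ‖z.1‖,
      ((tendsto_rpow_atTop hθ).comp hRlim).eventually_gt_atTop |z.2|] with n h1 h2
    have h2' : |z.2| < R n ^ θ := h2
    change ‖scaling (R n) (R n ^ θ) z‖ < 1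
    simp only [scaling_apply, Prod.norm_def, sup_lt_iff, norm_smul, norm_mul, norm_inv,
      Real.norm_eq_abs, abs_of_pos (hR0 n), abs_of_pos (hΘ0 n)]
    rw [inv_mul_lt_iff₀ (hR0 n), inv_mul_lt_iff₀ (hΘ0 n), mul_one, mul_one]
    exact ⟨h1, h2'⟩
  have igS : ∀ n, IntegrableOn g (S n) (muS m) := fun n =>
    (iφ n).integrableOn.congr_fun (fun z hz => hφS n z hz) (hSm n)
  have hSle : ∀ n, ∫ z in S n, g z ∂(muS m) ≤ ∫ z, u z ^ q * φ n z ∂(muS m) := fun n => by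
    rw [← setIntegral_congr_fun (hSm n) (fun z hz => hφS n z hz)]
    exact setIntegral_le_integral (iφ n) ((hφg n).mono fun z hz => hz.1)
  have ig : Integrable g (muS m) := by
    -- the factor of the tail is at most `1 / 2` for large `τ`
    obtain ⟨τ, hτ, hτ0⟩ : ∃ τ : ℝ, C * (τ ^ (p - 1 - q) + τ ^ (1 - q)) < 1 / 2 ∧ 0 < τ := by
      have h1 := tendsto_rpow_neg_atTop (y := q - (p - 1)) (by linarith)
      have h2 := tendsto_rpow_neg_atTop (y := q - 1) (by linarith)
      have h3 := (h1.add h2).const_mul C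
      simp only [neg_sub, add_zero, mul_zero] at h3
      exact ((h3.eventually_lt_const (by norm_num)).and (eventually_gt_atTop 0)).exists
    refine cover.integrable_of_integral_norm_bounded (2 * (C * (τ ^ (p - 1) + τ))) igS
      (Eventually.of_forall fun n => ?_)
    have h1 : ∫ z in S n, ‖g z‖ ∂(muS m) = ∫ z in S n, g z ∂(muS m) :=
      integral_congr_ae (ae_restrict_of_ae (hg0.mono fun z hz => abs_of_nonneg hz))
    have h2 := hmain (R n) τ δ (hR1 n) hτ0 hδ
    have h3 : ∫ z in {z | 1 ≤ ‖scaling (R n) (R n ^ θ) z‖}, u z ^ q * φ n z ∂(muS m)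
        ≤ ∫ z, u z ^ q * φ n z ∂(muS m) :=
      setIntegral_le_integral (iφ n) ((hφg n).mono fun z hz => hz.1)
    have h4 : 0 ≤ ∫ z, u z ^ q * φ n z ∂(muS m) :=
      integral_nonneg_of_ae ((hφg n).mono fun z hz => hz.1)
    have h5 : 0 ≤ C * (τ ^ (p - 1 - q) + τ ^ (1 - q)) := by positivity
    have h6 := (mul_le_mul_of_nonneg_left h3 h5).trans (mul_le_mul_of_nonneg_right hτ.le h4)
    have h7 := hSle n
    rw [h1]
    simp only [hφ] at h4 h6 h7
    linarith
  have hlim := cover.integral_tendsto_of_countably_generated ig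
  have hI : ∀ τ : ℝ, 0 < τ → ∫ z, g z ∂(muS m) ≤ C * (τ ^ (p - 1) + τ) := fun τ hτ => by
    set D := C * (τ ^ (p - 1 - q) + τ ^ (1 - q)) with hD
    have hD0 : 0 ≤ D := by positivity
    have hn : ∀ n, ∫ z in S n, g z ∂(muS m) ≤ C * (τ ^ (p - 1) + τ)
        + D * (∫ z, g z ∂(muS m) - ∫ z in S n, g z ∂(muS m)) := fun n => by
      refine (hSle n).trans ((hmain (R n) τ δ (hR1 n) hτ hδ).trans ?_)
      rw [hSc n, ← setIntegral_compl (hSm n) ig]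
      have h1 : ∫ z in (S n)ᶜ, u z ^ q * φ n z ∂(muS m) ≤ ∫ z in (S n)ᶜ, g z ∂(muS m) :=
        setIntegral_mono_ae (iφ n).integrableOn ig.integrableOn
          ((hφg n).mono fun z hz => hz.2)
      gcongr
    have hr := ((hlim.const_sub (∫ z, g z ∂(muS m))).const_mul D).const_add (C * (τ ^ (p - 1) + τ))
    simpa using le_of_tendsto_of_tendsto' hlim hr hn
  have hzero : ∫ z, g z ∂(muS m) ≤ 0 := by
    have h1 : Tendsto (fun τ : ℝ => C * (τ ^ (p - 1) + τ)) (𝓝[>] 0) (𝓝 (C * (0 ^ (p - 1) + 0))) :=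
      (((Real.continuousAt_rpow_const 0 (p - 1) (Or.inr (by linarith))).add
        continuousAt_id).const_mul C).tendsto.mono_left nhdsWithin_le_nhds
    rw [Real.zero_rpow (by linarith), add_zero, mul_zero] at h1
    exact ge_of_tendsto h1 (eventually_nhdsWithin_of_forall fun τ hτ => hI τ hτ)
  have hae := (integral_eq_zero_iff_of_nonneg_ae hg0 ig).1
    (le_antisymm hzero (integral_nonneg_of_ae hg0))
  filter_upwards [hae, hu0] with z hz huz ht
  have h1 : u z ^ q = 0 := by
    rcases mul_eq_zero.1 hz with h | h
    · exact h
    · exact absurd h (ramp_pos hδ ht).ne'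
  exact (Real.rpow_eq_zero huz hq0.ne').1 h1

end PLaplaceParabolic

theorem corollary1 (m : ℕ) (hm : 0 < m) (p q : ℝ) (hp : 1 < p)
    (hq : max 1 (p - 1) < q) (hq' : q ≤ p / (m : ℝ) + p - 1)
    (u₀ : PLaplaceParabolic.Space m → ℝ) (hu₀ : LocallyIntegrable u₀ volume)
    (hu₀_nonneg : ∀ᵐ x ∂(volume : Measure (PLaplaceParabolic.Space m)), 0 ≤ u₀ x)
    (u : PLaplaceParabolic.SpaceTime m → ℝ)
    (hu : PLaplaceParabolic.IsWeakSolution p q (fun _ => 1) u₀ u) :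
    ∀ᵐ z ∂(PLaplaceParabolic.muS m), u z = 0 := by
  have h := ae_all_iff.2 fun n : ℕ =>
    hu.ae_eq_zero_of_lt hm hp hq hq' (Nat.one_div_pos_of_nat (α := ℝ) (n := n))
  have hpos : ∀ᵐ z ∂(PLaplaceParabolic.muS m), 0 < z.2 :=
    ae_restrict_mem (PLaplaceParabolic.isOpen_upper m).measurableSet
  filter_upwards [h, hpos] with z hz ht
  obtain ⟨n, hn⟩ := exists_nat_one_div_lt ht
  exact hz n hn
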